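/- Let $p>2$ be a prime. For a finite $p$-group $X$ let $\mathbb{F}_pX$ be its group algebra over the field with $p$ elements, and let $$V(\mathbb{F}_pX)=\Bigl\{\sum_{x\in X}\alpha_x x\in\mathbb{F}_pX \;\Bigm|\; \sum_{x\in X}\alpha_x=1\Bigr\}$$ be its group of normalized units (every such element is a unit, since $X$ is a finite $p$-group). Write $\zeta(X)$ for the center and $\exp(X)$ for the exponent of $X$. Let $G$ and $H$ be finite nonabelian $p$-groups, each with cyclic Frattini subgroup. Then: 1. $V(\mathbb{F}_pG)$ and $V(\mathbb{F}_pH)$ are isomorphic if and only if $G$ and $H$ are isomorphic. 2. If $V(\mathbb{F}_pG)\cong V(\mathbb{F}_pH)$, then $|G|=|H|$, $|\zeta(G)|=|\zeta(H)|$, $\exp(\zeta(G))=\exp(\zeta(H))$ and $\exp(G)=\exp(H)$. 3. If $|G|=|H|$, $|\zeta(G)|=|\zeta(H)|$, $\exp(\zeta(G))=\exp(\zeta(H))$ and $\exp(G)=\exp(H)$, then $G\cong H$. -/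

import Mathlib

/-- The augmentation map `∑ α_g g ↦ ∑ α_g` of the group algebra of `G` over `R`. -/
noncomputable def augmentation (R G : Type*) [CommRing R] [Group G] :
    MonoidAlgebra R G →ₐ[R] R :=
  MonoidAlgebra.lift R R G (1 : G →* R)

/-- The group of normalized units of the group algebra of `G` over `R`: the units whose
coefficients add up to `1` (see `mem_normalizedUnits`). -/
noncomputable def normalizedUnits (R G : Type*) [CommRing R] [Group G] :
    Subgroup (MonoidAlgebra R G)ˣ :=
  (Units.map (augmentation R G : MonoidAlgebra R G →* R)).ker

theorem augmentation_apply {R G : Type*} [CommRing R] [Group G]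
    (x : MonoidAlgebra R G) : augmentation R G x = x.coeff.sum fun _ a => a := by
  simp [augmentation, MonoidAlgebra.lift_apply]

theorem mem_normalizedUnits {R G : Type*} [CommRing R] [Group G]
    {u : (MonoidAlgebra R G)ˣ} :
    u ∈ normalizedUnits R G ↔ ((u : MonoidAlgebra R G).coeff.sum fun _ a => a) = 1 := by
  rw [← augmentation_apply]
  simp [normalizedUnits, MonoidHom.mem_ker, Units.ext_iff]

/-! Write V for the normalized units, N for 1 + c + ⋯ + c^(p-1), and Z_2(V) for the second center.
Since p is odd, a nonabelian p-group G with cyclic Frattini subgroup has a central commutator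
subgroup ⟨c⟩ of order p, and its p-th powers are central (`exists_isCommutatorGenerator`).

Orders of the invariants: |V| = p^(|G|-1) and |Z(V)| = p^(k(G)-1), with k(G) the class number.
Noncentral classes are cosets of ⟨c⟩, so |G| and k(G) determine |Z(G)|.

Exponents: u^p differs from the sum of the p-th powers of its terms by an error N r, with r
supported off Z(G) (`exists_pow_char_eq`). Since N² = 0, one further p-th power removes the error,
and a similar decomposition of central units gives exp Z(V) = exp Z(G). For exp G the error matters
only if exp G = p. It is absorbed by [Z_2(V), V], which contains every unit 1 + N r of this kind,
while its elements are congruent to 1 modulo the annihilator of c - 1, so that it meets G trivially.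
Hence exp G is the exponent of V/[Z_2(V), V].

Classification: commutators make G/Z(G) a symplectic space over the field with p elements, and the
p-th power map is a homomorphism with cyclic image. The centers are matched by an isomorphism
respecting a suitable element b, and then pairs x, y with commutator c are split off. They satisfy
x^p = y^p = 1, except for one pair with x^p = b, y^p = 1 when exp G ≠ exp Z(G). Partial isomorphisms
are encoded as subgroups of G × H, and a maximal one is (up to that last pair) an isomorphism
(`nonempty_mulEquiv_of_invariants_eq`). The equivalence of the two isomorphism relations combines
these results. -/

/-- `c` is a central element of order `p` whose powers contain all commutators. -/
structure IsCommutatorGenerator (p : ℕ) {G : Type*} [Group G] (c : G) : Prop where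
  mem_center : c ∈ Subgroup.center G
  orderOf_eq : orderOf c = p
  exists_pow : ∀ g h : G, ∃ i : ℕ, g * h = c ^ i * (h * g)

/-! ### Trace forms and p-th powers in characteristic p. -/

namespace MonoidAlgebra

section Trace

variable {p : ℕ} [Fact p.Prime] {A M : Type*} [Ring A] [CharP A p] [AddCommGroup M]

theorem trace_coeff_mul_comm (τ : A →+ M) (hτ : ∀ a b, τ (a * b) = τ (b * a))
    (P Q : Polynomial A) (n : ℕ) : τ ((P * Q).coeff n) = τ ((Q * P).coeff n) := by
  rw [Polynomial.coeff_mul, Polynomial.coeff_mul, map_sum, map_sum,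
    ← Finset.Nat.sum_antidiagonal_swap]
  exact Finset.sum_congr rfl fun i _ => hτ _ _

theorem trace_coeff_derivative_pow (τ : A →+ M) (hτ : ∀ a b, τ (a * b) = τ (b * a))
    (P : Polynomial A) (m n : ℕ) :
    τ ((Polynomial.derivative (P ^ m)).coeff n) =
      m • τ ((P ^ (m - 1) * Polynomial.derivative P).coeff n) := by
  -- The extra left factor Q makes the induction on the product rule go through; cyclicity of τ then
  -- moves every P to the left.
  have key : ∀ (m : ℕ) (Q : Polynomial A),
      τ ((Q * Polynomial.derivative (P ^ m)).coeff n) =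
        ∑ i ∈ Finset.range m,
          τ ((P ^ (m - 1 - i) * Q * P ^ i * Polynomial.derivative P).coeff n) := by
    intro m
    induction m with
    | zero => intro Q; simp
    | succ m ih =>
      intro Q
      rw [pow_succ', Polynomial.derivative_mul, mul_add, Polynomial.coeff_add, map_add,
        ← mul_assoc, ← mul_assoc, ih, Finset.sum_range_succ', add_comm]
      congr 1
      · refine Finset.sum_congr rfl fun i hi => ?_
        rw [Finset.mem_range] at hi
        have : m + 1 - 1 - (i + 1) = m - 1 - i := by omega
        rw [this, pow_succ' P i]
        simp only [mul_assoc]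
      · rw [trace_coeff_mul_comm τ hτ]
        simp [mul_assoc]
  have := key m 1
  rw [one_mul] at this
  rw [this, Finset.sum_congr rfl (g := fun _ =>
    τ ((P ^ (m - 1) * Polynomial.derivative P).coeff n))]
  · simp
  · intro i hi
    rw [Finset.mem_range] at hi
    rw [mul_one, ← pow_add]
    congr 5
    omega

/-- The mixed terms of (x + y)^p are the middle coefficients of (xX + y)^p. Differentiating in X
multiplies the coefficient of X^(n+1) by n + 1, while under τ the derivative of a p-th power is a
multiple of p. -/
theorem trace_add_pow_char (τ : A →+ M) (hτ : ∀ a b, τ (a * b) = τ (b * a)) (x y : A) :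
    τ ((x + y) ^ p) = τ (x ^ p) + τ (y ^ p) := by
  have hp := (Fact.out : p.Prime)
  set P : Polynomial A := Polynomial.C x * Polynomial.X + Polynomial.C y with hP
  have hM : ∀ a : A, p • τ a = 0 := fun a => by
    rw [← map_nsmul, nsmul_eq_mul, CharP.cast_eq_zero, zero_mul, map_zero]
  have h0 : ∀ n, n + 1 < p → τ ((P ^ p).coeff (n + 1)) = 0 := by
    intro n hn
    have h1 := trace_coeff_derivative_pow τ hτ P p n
    rw [hM, Polynomial.coeff_derivative] at h1
    have h2 : (n + 1) • τ ((P ^ p).coeff (n + 1)) = 0 := by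
      rw [← h1, ← map_nsmul, nsmul_eq_mul]
      congr 1
      exact_mod_cast (Nat.cast_commute (n + 1) _)
    have hc : Nat.Coprime (n + 1) p :=
      Nat.Coprime.symm ((Nat.Prime.coprime_iff_not_dvd hp).2
        fun h => absurd (Nat.le_of_dvd (Nat.succ_pos _) h) (by omega))
    -- The value is killed by the coprime numbers n + 1 and p, hence is zero.
    have h3 := hM ((P ^ p).coeff (n + 1))
    have h4 := Nat.dvd_gcd (addOrderOf_dvd_iff_nsmul_eq_zero.2 h2)
      (addOrderOf_dvd_iff_nsmul_eq_zero.2 h3)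
    rw [hc.gcd_eq_one] at h4
    simpa using addOrderOf_dvd_iff_nsmul_eq_zero.1 h4
  have hdeg1 : P.natDegree ≤ 1 := Polynomial.natDegree_linear_le
  have hdeg : (P ^ p).natDegree < p + 1 := by
    have := Polynomial.natDegree_pow_le_of_le p hdeg1
    omega
  have hev : (x + y) ^ p = ∑ i ∈ Finset.range (p + 1), (P ^ p).coeff i := by
    have h5 : (P ^ p).eval 1 = (x + y) ^ p := by
      have h6 := map_pow (Polynomial.eval₂RingHom' (RingHom.id A) 1 fun a => Commute.one_right a) P p
      have h7 : ∀ Q : Polynomial A,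
        Polynomial.eval₂RingHom' (RingHom.id A) 1 (fun a => Commute.one_right a) Q = Q.eval 1 :=
          fun _ => rfl
      rw [h7, h7] at h6
      rw [h6]
      simp [hP]
    rw [← h5, Polynomial.eval_eq_sum_range' hdeg]
    simp
  have hlead : (P ^ p).coeff p = x ^ p := by
    have := Polynomial.coeff_pow_of_natDegree_le (m := p) hdeg1
    simpa [hP] using this
  have hzero : (P ^ p).coeff 0 = y ^ p := by
    rw [← Polynomial.constantCoeff_apply, map_pow]
    simp [hP]
  rw [hev, map_sum, Finset.sum_range_succ, hlead, add_comm]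
  congr 1
  obtain ⟨k, hk⟩ : ∃ k, p = k + 1 := ⟨p - 1, by have := hp.pos; omega⟩
  rw [hk, Finset.sum_range_succ', ← hk, hzero, Finset.sum_eq_zero, zero_add]
  intro i hi
  exact h0 i (by rw [Finset.mem_range] at hi; omega)

end Trace
end MonoidAlgebra

section

variable {p : ℕ} {G : Type*} [Group G] {c : G}

theorem IsCommutatorGenerator.mul_comm (hc : IsCommutatorGenerator p c) (g : G) :
    g * c = c * g :=
  Subgroup.mem_center_iff.1 hc.mem_center g

theorem IsCommutatorGenerator.pow_eq_one (hc : IsCommutatorGenerator p c) : c ^ p = 1 := by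
  rw [← hc.orderOf_eq, pow_orderOf_eq_one]

theorem IsCommutatorGenerator.zpow_eq_one_iff (hc : IsCommutatorGenerator p c) {i : ℤ} :
    c ^ i = 1 ↔ (p : ℤ) ∣ i := by
  rw [← orderOf_dvd_iff_zpow_eq_one, hc.orderOf_eq]

theorem IsCommutatorGenerator.commute (hc : IsCommutatorGenerator p c) (g : G) : Commute c g :=
  (hc.mul_comm g).symm

end

/-! ### The group algebra, the element c - 1 and its annihilator. -/

namespace MonoidAlgebra

section CyclicCommutator

variable {p : ℕ} [hp : Fact p.Prime] {G : Type*} [Group G] {c : G}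

instance charP_zmod : CharP (MonoidAlgebra (ZMod p) G) p :=
  charP_of_injective_algebraMap (algebraMap (ZMod p) (MonoidAlgebra (ZMod p) G)).injective p

/-- The element `c - 1` of the group algebra. -/
noncomputable def subOne (p : ℕ) {G : Type*} [Group G] (c : G) : MonoidAlgebra (ZMod p) G :=
  single c 1 - 1

theorem commute_of_forall_single {x : MonoidAlgebra (ZMod p) G}
    (h : ∀ g, Commute (single g 1) x) (y : MonoidAlgebra (ZMod p) G) : Commute y x := by
  induction y using MonoidAlgebra.induction_on with
  | of g => exact h g
  | add a b ha hb => exact ha.add_left hb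
  | smul _ _ ha => exact ha.smul_left _

theorem commute_single_center {z : G} (hz : z ∈ Subgroup.center G) (a : ZMod p)
    (x : MonoidAlgebra (ZMod p) G) : Commute (single z a) x :=
  single_commute (fun g => (Subgroup.mem_center_iff.1 hz g).symm) (fun _ => Commute.all _ _) x

theorem subOne_commute (hc : IsCommutatorGenerator p c) (x : MonoidAlgebra (ZMod p) G) :
    Commute (subOne p c) x :=
  (commute_single_center hc.mem_center 1 x).sub_left (Commute.one_left x)

theorem subOne_pow (hc : IsCommutatorGenerator p c) : subOne p c ^ p = 0 := by
  rw [subOne, sub_pow_char_of_commute _ (Commute.one_right _), single_pow, hc.pow_eq_one]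
  simp [one_def]

theorem subOne_dvd_single_pow_sub_one (i : ℕ) :
    subOne p c ∣ (single (c ^ i) 1 - 1 : MonoidAlgebra (ZMod p) G) := by
  have : (single (c ^ i) 1 : MonoidAlgebra (ZMod p) G) = single c 1 ^ i := by
    rw [single_pow, one_pow]
  rw [this]
  exact sub_one_dvd_pow_sub_one _ i

theorem subOne_dvd_commutator (hc : IsCommutatorGenerator p c)
    (x y : MonoidAlgebra (ZMod p) G) : subOne p c ∣ x * y - y * x := by
  have dsmul : ∀ (r : ZMod p) (a : MonoidAlgebra (ZMod p) G), subOne p c ∣ a →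
      subOne p c ∣ r • a := by
    rintro r _ ⟨b, rfl⟩
    exact ⟨r • b, by simp⟩
  induction x using MonoidAlgebra.induction_on with
  | of g =>
    induction y using MonoidAlgebra.induction_on with
    | of h =>
      obtain ⟨i, hi⟩ := hc.exists_pow g h
      obtain ⟨r, hr⟩ := subOne_dvd_single_pow_sub_one (p := p) (c := c) i
      refine ⟨r * single (h * g) 1, ?_⟩
      rw [← mul_assoc, ← hr, sub_mul, one_mul]
      simp [single_mul_single, hi]
    | add a b ha hb =>
      rw [mul_add, add_mul, add_sub_add_comm]
      exact dvd_add ha hb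
    | smul r a ha =>
      rw [mul_smul_comm, smul_mul_assoc, ← smul_sub]
      exact dsmul r _ ha
  | add a b ha hb =>
    rw [mul_add, add_mul, add_sub_add_comm]
    exact dvd_add ha hb
  | smul r a ha =>
    rw [mul_smul_comm, smul_mul_assoc, ← smul_sub]
    exact dsmul r _ ha

/-- The `p`-th powers in the group algebra are central: `(ad u) ^ p = ad (u ^ p)` maps into
the multiples of `(c - 1) ^ p = 0`. -/
theorem pow_char_commute (hc : IsCommutatorGenerator p c) (u v : MonoidAlgebra (ZMod p) G) :
    Commute (u ^ p) v := by
  set L : Module.End (ZMod p) (MonoidAlgebra (ZMod p) G) := LinearMap.mulLeft (ZMod p) u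
  set R : Module.End (ZMod p) (MonoidAlgebra (ZMod p) G) := LinearMap.mulRight (ZMod p) u
  have hLR : Commute L R := LinearMap.commute_mulLeft_right _ _
  have : CharP (Module.End (ZMod p) (MonoidAlgebra (ZMod p) G)) p :=
    charP_of_injective_algebraMap (algebraMap (ZMod p) (Module.End (ZMod p) _)).injective p
  have key : ∀ n, ∃ r, ((L - R) ^ n) v = subOne p c ^ n * r := by
    intro n
    induction n with
    | zero => exact ⟨v, by simp⟩
    | succ n ih =>
      obtain ⟨r, hr⟩ := ih
      obtain ⟨s, hs⟩ := subOne_dvd_commutator hc u r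
      refine ⟨s, ?_⟩
      rw [pow_succ', Module.End.mul_apply, hr, pow_succ, mul_assoc, ← hs]
      have : Commute u (subOne p c ^ n) := ((subOne_commute hc u).pow_left n).symm
      simp only [L, R, LinearMap.sub_apply, LinearMap.mulLeft_apply, LinearMap.mulRight_apply,
        mul_sub]
      rw [← mul_assoc, this.eq, mul_assoc, mul_assoc]
  obtain ⟨r, hr⟩ := key p
  rw [sub_pow_char_of_commute _ hLR, subOne_pow hc, zero_mul, LinearMap.sub_apply, sub_eq_zero,
    LinearMap.pow_mulLeft, LinearMap.pow_mulRight] at hr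
  exact hr

/-- For central z, gh = z if and only if hg = z. So taking the coefficient at z is a trace form, to
which `trace_add_pow_char` applies. -/
theorem coeff_mul_comm_of_mem_center {z : G} (hz : z ∈ Subgroup.center G)
    (x y : MonoidAlgebra (ZMod p) G) : (x * y).coeff z = (y * x).coeff z := by
  induction x using MonoidAlgebra.induction_on with
  | of g =>
    rw [of_apply, coeff_single_mul_apply, coeff_mul_single_apply, one_mul, mul_one,
      Subgroup.mem_center_iff.1 hz]
  | add a b ha hb => simp [mul_add, add_mul, ha, hb]
  | smul r a ha => simp [ha]

/-- The linear extension of `g ↦ g ^ n` to the group algebra. -/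
noncomputable abbrev powMap (n : ℕ) (x : MonoidAlgebra (ZMod p) G) : MonoidAlgebra (ZMod p) G :=
  mapDomain (fun g : G => g ^ n) x

theorem coeff_pow_char_of_mem_center {z : G} (hz : z ∈ Subgroup.center G)
    (u : MonoidAlgebra (ZMod p) G) : (u ^ p).coeff z = (powMap p u).coeff z := by
  let τ : MonoidAlgebra (ZMod p) G →+ ZMod p :=
    (Finsupp.applyAddHom z).comp coeffAddEquiv.toAddMonoidHom
  have hτ : ∀ x, τ x = x.coeff z := fun _ => rfl
  rw [← hτ, ← hτ]
  induction u using MonoidAlgebra.induction_linear with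
  | zero => simp [powMap, hp.out.ne_zero]
  | add x y hx hy =>
    rw [trace_add_pow_char τ (fun a b => by simpa [hτ] using coeff_mul_comm_of_mem_center hz a b),
      hx, hy, ← map_add, powMap, powMap, powMap, mapDomain_add]
  | single m r => simp [powMap, single_pow, ZMod.pow_card]

theorem coeff_conj_of_commute {x : MonoidAlgebra (ZMod p) G}
    (h : ∀ y, Commute x y) (a g : G) : x.coeff (a * g * a⁻¹) = x.coeff g := by
  have h1 := h (single a 1)
  have h2 := congrArg (fun w => w.coeff (a * g)) h1.eq
  simp only [coeff_single_mul_apply, coeff_mul_single_apply, one_mul, mul_one] at h2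
  rw [h2]
  group

/-- As commutators are central, h ↦ [h, g] is multiplicative. A nontrivial value c^i generates ⟨c⟩,
so some power of h gives exactly c. -/
theorem exists_conj_eq_mul (hc : IsCommutatorGenerator p c) {g : G}
    (hg : g ∉ Subgroup.center G) : ∃ a : G, a * g * a⁻¹ = c * g := by
  rw [Subgroup.mem_center_iff] at hg
  push Not at hg
  obtain ⟨h, hh⟩ := hg
  obtain ⟨i, hi⟩ := hc.exists_pow h g
  have hi0 : ¬ p ∣ i := by
    rintro ⟨k, rfl⟩
    rw [pow_mul, hc.pow_eq_one, one_pow, one_mul] at hi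
    exact hh hi
  have hn : ∀ n : ℕ, h ^ n * g * (h ^ n)⁻¹ = (c ^ i) ^ n * g := by
    intro n
    induction n with
    | zero => simp
    | succ n ih =>
      have : h * (c ^ i) ^ n = (c ^ i) ^ n * h := by
        rw [← pow_mul]
        exact (Commute.pow_right (show Commute h c from hc.mul_comm h) _).eq
      calc h ^ (n + 1) * g * (h ^ (n + 1))⁻¹ = h * (h ^ n * g * (h ^ n)⁻¹) * h⁻¹ := by
            rw [pow_succ']; group
        _ = (c ^ i) ^ n * (h * g) * h⁻¹ := by rw [ih, ← mul_assoc, this]; group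
        _ = (c ^ i) ^ (n + 1) * g := by rw [hi, pow_succ]; group
  obtain ⟨m, hm⟩ := Nat.exists_mul_mod_eq_one_of_coprime
    ((Nat.coprime_comm).1 ((Nat.Prime.coprime_iff_not_dvd hp.out).2 hi0)) hp.out.one_lt
  refine ⟨h ^ m, ?_⟩
  rw [hn, ← pow_mul, ← Nat.mod_add_div (i * m) p, hm.2, pow_add, pow_mul, hc.pow_eq_one]
  simp

theorem coeff_mul_of_commute (hc : IsCommutatorGenerator p c) {x : MonoidAlgebra (ZMod p) G}
    (h : ∀ y, Commute x y) {g : G} (hg : g ∉ Subgroup.center G) :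
    x.coeff (c * g) = x.coeff g := by
  obtain ⟨a, ha⟩ := exists_conj_eq_mul hc hg
  rw [← ha, coeff_conj_of_commute h]

/-- Multiplying a central element by `c - 1` kills the coefficients outside the center of `G`. -/
theorem coeff_subOne_mul_of_commute (hc : IsCommutatorGenerator p c)
    {x : MonoidAlgebra (ZMod p) G} (h : ∀ y, Commute x y) {g : G}
    (hg : g ∉ Subgroup.center G) : (subOne p c * x).coeff g = 0 := by
  have h1 : c⁻¹ * g ∉ Subgroup.center G := by
    rw [Subgroup.mul_mem_cancel_left _ (inv_mem hc.mem_center)]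
    exact hg
  have h2 := coeff_mul_of_commute hc h h1
  rw [mul_inv_cancel_left] at h2
  rw [subOne, sub_mul, one_mul, coeff_sub, Finsupp.sub_apply, coeff_single_mul_apply, h2, one_mul,
    sub_self]

theorem subOne_mul_eq_zero_of_commute (hc : IsCommutatorGenerator p c)
    {x : MonoidAlgebra (ZMod p) G} (h : ∀ y, Commute x y)
    (h0 : ∀ z ∈ Subgroup.center G, x.coeff z = 0) : subOne p c * x = 0 := by
  ext g
  by_cases hg : g ∈ Subgroup.center G
  · rw [subOne, sub_mul, one_mul, coeff_sub, Finsupp.sub_apply, coeff_single_mul_apply, h0 g hg,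
      h0 _ (mul_mem (inv_mem hc.mem_center) hg)]
    simp
  · simpa using coeff_subOne_mul_of_commute hc h hg

/-- The sum of the powers of `c`. -/
noncomputable def sumPow (p : ℕ) {G : Type*} [Group G] (c : G) : MonoidAlgebra (ZMod p) G :=
  ∑ i ∈ Finset.range p, single (c ^ i) 1

/-- The sum of `i c ^ i`. -/
noncomputable def sumMulPow (p : ℕ) {G : Type*} [Group G] (c : G) : MonoidAlgebra (ZMod p) G :=
  ∑ i ∈ Finset.range p, single (c ^ i) (i : ZMod p)

theorem sumPow_commute (hc : IsCommutatorGenerator p c) (x : MonoidAlgebra (ZMod p) G) :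
    Commute (sumPow p c) x :=
  Commute.sum_left _ _ _ fun i _ => commute_single_center (pow_mem hc.mem_center i) _ x

theorem sumMulPow_commute (hc : IsCommutatorGenerator p c) (x : MonoidAlgebra (ZMod p) G) :
    Commute (sumMulPow p c) x :=
  Commute.sum_left _ _ _ fun i _ => commute_single_center (pow_mem hc.mem_center i) _ x

theorem subOne_mul_sumPow (hc : IsCommutatorGenerator p c) : subOne p c * sumPow p c = 0 := by
  have : sumPow p c = ∑ i ∈ Finset.range p, (single c 1 : MonoidAlgebra (ZMod p) G) ^ i := by
    simp [sumPow, single_pow]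
  rw [this, subOne, mul_geom_sum, single_pow, hc.pow_eq_one]
  simp [one_def]

/-- The product telescopes, and the boundary term p c^p vanishes in characteristic p. -/
theorem subOne_mul_sumMulPow (hc : IsCommutatorGenerator p c) :
    subOne p c * sumMulPow p c = - sumPow p c := by
  have h : ∀ n : ℕ, subOne p c * ∑ i ∈ Finset.range n, single (c ^ i) (i : ZMod p) =
      single (c ^ n) (n : ZMod p) - single c 1 * ∑ i ∈ Finset.range n, single (c ^ i) 1 := by
    intro n
    induction n with
    | zero => simp
    | succ n ih =>
      rw [Finset.sum_range_succ, mul_add, ih, Finset.sum_range_succ, mul_add, subOne, sub_mul,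
        one_mul, single_mul_single, single_mul_single, ← pow_succ']
      push_cast
      rw [single_add]
      simp only [one_mul, mul_one]
      abel
  have h2 := subOne_mul_sumPow hc
  rw [subOne, sub_mul, one_mul, sub_eq_zero] at h2
  rw [sumMulPow, h, CharP.cast_eq_zero, ← sumPow, h2]
  simp

end CyclicCommutator
end MonoidAlgebra

namespace MonoidAlgebra

section CyclicCommutator

variable {p : ℕ} [hp : Fact p.Prime] {G : Type*} [Group G] {c : G}

theorem single_pow_mul_sumPow (hc : IsCommutatorGenerator p c) (i : ℕ) :
    single (c ^ i) 1 * sumPow p c = sumPow p c := by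
  obtain ⟨r, hr⟩ := subOne_dvd_single_pow_sub_one (p := p) (c := c) i
  have h : (single (c ^ i) 1 - 1) * sumPow p c = 0 := by
    rw [hr, (subOne_commute hc r).eq, mul_assoc, subOne_mul_sumPow hc, mul_zero]
  rwa [sub_mul, one_mul, sub_eq_zero] at h

theorem sumPow_mul_self (hc : IsCommutatorGenerator p c) : sumPow p c * sumPow p c = 0 := by
  conv_lhs => enter [1]; rw [sumPow]
  rw [Finset.sum_mul, Finset.sum_congr rfl fun i _ => single_pow_mul_sumPow hc i]
  rw [Finset.sum_const, Finset.card_range, nsmul_eq_mul, CharP.cast_eq_zero, zero_mul]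

theorem sumPow_mul_mul_sumPow (hc : IsCommutatorGenerator p c) (x y : MonoidAlgebra (ZMod p) G) :
    (sumPow p c * x) * (sumPow p c * y) = 0 := by
  rw [(sumPow_commute hc x).eq, mul_assoc, ← mul_assoc (sumPow p c), sumPow_mul_self hc, zero_mul,
    mul_zero]

theorem coeff_pow_mul_of_subOne_mul (w : MonoidAlgebra (ZMod p) G)
    (hw : subOne p c * w = 0) (i : ℕ) (g : G) : w.coeff (c ^ i * g) = w.coeff g := by
  induction i with
  | zero => simp
  | succ i ih =>
    have := congrArg (fun x => x.coeff (c ^ (i + 1) * g)) hw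
    simp only [subOne, sub_mul, one_mul, coeff_sub, Finsupp.sub_apply, coeff_single_mul_apply,
      coeff_zero, Finsupp.coe_zero, Pi.zero_apply, sub_eq_zero] at this
    rw [← this, pow_succ', mul_assoc, inv_mul_cancel_left, ih]

/-- The annihilator of `c - 1` is generated by the sum of the powers of `c`. -/
theorem exists_eq_sumPow_mul (hc : IsCommutatorGenerator p c) (w : MonoidAlgebra (ZMod p) G)
    (hw : subOne p c * w = 0) :
    ∃ r, w = sumPow p c * r ∧ ∀ g, r.coeff g ≠ 0 → w.coeff g ≠ 0 := by
  classical
  induction hn : w.coeff.support.card using Nat.strong_induction_on generalizing w with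
  | _ n ih =>
    by_cases h0 : w = 0
    · exact ⟨0, by simp [h0], by simp⟩
    obtain ⟨x, hx⟩ : ∃ x, w.coeff x ≠ 0 := by
      by_contra! h
      exact h0 (by ext g; simp [h g])
    -- Being killed by c - 1, w is constant on ⟨c⟩x. Subtracting N s clears that coset without
    -- enlarging the support.
    set s : MonoidAlgebra (ZMod p) G := single x (w.coeff x) with hs
    have hcoeff : ∀ g, (sumPow p c * s).coeff g =
        ∑ i ∈ Finset.range p, if c ^ i * x = g then w.coeff x else 0 := by
      intro g
      rw [sumPow, Finset.sum_mul, coeff_sum, Finsupp.finsetSum_apply]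
      refine Finset.sum_congr rfl fun i _ => ?_
      rw [hs, single_mul_single, coeff_single, one_mul, Finsupp.single_apply]
    have hx1 : (sumPow p c * s).coeff x = w.coeff x := by
      rw [hcoeff, Finset.sum_eq_single 0]
      · simp
      · intro i hi hi0
        rw [if_neg]
        intro h
        have h1 : c ^ i = 1 := by simpa using h
        have := Nat.le_of_dvd (Nat.pos_of_ne_zero hi0) (orderOf_dvd_of_pow_eq_one h1)
        rw [hc.orderOf_eq] at this
        simp at hi
        omega
      · intro h
        simp [hp.out.pos] at h
    have hzero : ∀ g, w.coeff g = 0 → (sumPow p c * s).coeff g = 0 := by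
      intro g hg
      rw [hcoeff, Finset.sum_eq_zero]
      intro i _
      rw [if_neg]
      rintro rfl
      rw [coeff_pow_mul_of_subOne_mul w hw] at hg
      exact hx hg
    set w' := w - sumPow p c * s with hw'
    have hsub : ∀ g, w.coeff g = 0 → w'.coeff g = 0 := by
      intro g hg
      rw [hw', coeff_sub, Finsupp.sub_apply, hg, hzero g hg, sub_zero]
    have hlt : w'.coeff.support.card < n := by
      rw [← hn]
      refine Finset.card_lt_card (Finset.ssubset_iff_of_subset ?_ |>.2 ⟨x, ?_, ?_⟩)
      · intro g hg
        rw [Finsupp.mem_support_iff] at hg ⊢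
        exact fun h => hg (hsub g h)
      · simpa using hx
      · simp [hw', hx1]
    obtain ⟨r, hr, hrs⟩ := ih _ hlt w' (by
      rw [hw', mul_sub, hw, ← mul_assoc, subOne_mul_sumPow hc, zero_mul, sub_zero]) rfl
    refine ⟨r + s, by rw [mul_add, ← hr, hw', sub_add_cancel], fun g hg => ?_⟩
    by_cases hgx : g = x
    · rwa [hgx]
    · have : s.coeff g = 0 := by
        rw [hs, coeff_single, Finsupp.single_apply, if_neg (Ne.symm hgx)]
      rw [coeff_add, Finsupp.add_apply, this, add_zero] at hg
      exact fun h => hrs g hg (hsub g h)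

/-! ### Iterated p-th powers in the group algebra. -/

theorem commute_of_coeff_eq_zero {x : MonoidAlgebra (ZMod p) G}
    (hx : ∀ g ∉ Subgroup.center G, x.coeff g = 0) (y : MonoidAlgebra (ZMod p) G) :
    Commute x y := by
  rw [← sum_coeff_single x, Finsupp.sum]
  refine Commute.sum_left _ _ _ fun g hg => commute_single_center ?_ _ y
  by_contra h
  exact (Finsupp.mem_support_iff.1 hg) (hx g h)

theorem coeff_powMap_eq_zero {n : ℕ} (h : ∀ g : G, g ^ n ∈ Subgroup.center G)
    (u : MonoidAlgebra (ZMod p) G) {g : G} (hg : g ∉ Subgroup.center G) :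
    (powMap n u).coeff g = 0 := by
  rw [powMap, mapDomain]
  refine Finsupp.mapDomain_of_notMem_range _ _ ?_
  rintro ⟨x, rfl⟩
  exact hg (h x)

theorem pow_char_pow_of_coeff_eq_zero (k : ℕ) (x : MonoidAlgebra (ZMod p) G)
    (hx : ∀ g ∉ Subgroup.center G, x.coeff g = 0) : x ^ p ^ k = powMap (p ^ k) x := by
  induction x using MonoidAlgebra.induction with
  | zero => simp [powMap, hp.out.ne_zero]
  | single_add m r x hm hr ih =>
    have hmc : m ∈ Subgroup.center G := by
      by_contra h
      have := hx m h
      rw [coeff_add, Finsupp.add_apply, Finsupp.notMem_support_iff.1 hm] at this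
      simp [hr] at this
    rw [add_pow_char_pow_of_commute _ _ (commute_single_center hmc r x), ih]
    · simp [powMap, mapDomain_add, single_pow, ZMod.pow_card_pow]
    · intro g hg
      have := hx g hg
      have hne : m ≠ g := by
        rintro rfl
        exact hg hmc
      simpa [Finsupp.single_apply, hne] using this

theorem powMap_powMap (m n : ℕ) (x : MonoidAlgebra (ZMod p) G) :
    powMap n (powMap m x) = powMap (m * n) x := by
  induction x using MonoidAlgebra.induction_linear with
  | zero => simp [powMap]
  | add x y hx hy =>
    simp only [powMap, mapDomain_add] at *
    rw [hx, hy]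
  | single g r => simp [powMap, pow_mul]

theorem powMap_eq_of_forall_pow_eq_one {n : ℕ} {x : MonoidAlgebra (ZMod p) G}
    (h : ∀ g, x.coeff g ≠ 0 → g ^ n = 1) :
    powMap n x = algebraMap (ZMod p) _ (augmentation (ZMod p) G x) := by
  induction x using MonoidAlgebra.induction with
  | zero => simp [powMap]
  | single_add m r x hm hr ih =>
    have hmn : m ^ n = 1 := h m (by
      rw [coeff_add, Finsupp.add_apply, Finsupp.notMem_support_iff.1 hm]
      simpa using hr)
    rw [powMap, mapDomain_add, ← powMap, ← powMap, ih, map_add, map_add]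
    · simp [powMap, hmn, augmentation]
    · intro g hg
      refine h g ?_
      have : m ≠ g := by
        rintro rfl
        exact hg (Finsupp.notMem_support_iff.1 hm)
      simpa [Finsupp.single_apply, this] using hg

/-- A `p`-th power is the sum of the `p`-th powers of its terms and of a central element that is
supported outside the center of `G` and killed by `c - 1`. -/
theorem exists_pow_char_eq (hc : IsCommutatorGenerator p c)
    (hpow : ∀ g : G, g ^ p ∈ Subgroup.center G) (u : MonoidAlgebra (ZMod p) G) :
    ∃ r, u ^ p = powMap p u + sumPow p c * r ∧
      ∀ g ∈ Subgroup.center G, r.coeff g = 0 := by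
  -- The difference is central and, by the trace argument, has no coefficients on Z(G); so it is
  -- killed by c - 1.
  have h1 : ∀ y, Commute (u ^ p - powMap p u) y := fun y =>
    (pow_char_commute hc u y).sub_left
      (commute_of_coeff_eq_zero (fun g hg => coeff_powMap_eq_zero hpow u hg) y)
  have h2 : ∀ z ∈ Subgroup.center G, (u ^ p - powMap p u).coeff z = 0 := fun z hz => by
    rw [coeff_sub, Finsupp.sub_apply, coeff_pow_char_of_mem_center hz, sub_self]
  obtain ⟨r, hr, hrs⟩ := exists_eq_sumPow_mul hc _ (subOne_mul_eq_zero_of_commute hc h1 h2)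
  refine ⟨r, by rw [← hr]; abel, fun g hg => ?_⟩
  by_contra h
  exact hrs g h (h2 g hg)

/-- Central x lets Frobenius split the sum, and (N r)² = 0 kills the second term because p^k ≥ 2. -/
theorem pow_char_pow_add_sumPow_mul (hc : IsCommutatorGenerator p c) {k : ℕ} (hk : k ≠ 0)
    (x r : MonoidAlgebra (ZMod p) G) (hx : ∀ g ∉ Subgroup.center G, x.coeff g = 0) :
    (x + sumPow p c * r) ^ p ^ k = powMap (p ^ k) x := by
  rw [add_pow_char_pow_of_commute _ _ (commute_of_coeff_eq_zero hx _),
    pow_char_pow_of_coeff_eq_zero k x hx]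
  obtain ⟨m, hm⟩ : ∃ m, p ^ k = 2 + m := by
    refine Nat.exists_eq_add_of_le (hp.out.two_le.trans ?_)
    exact Nat.le_self_pow hk p
  conv_lhs => enter [2]; rw [hm, pow_add, sq, sumPow_mul_mul_sumPow hc, zero_mul]
  rw [add_zero]

theorem pow_char_pow_eq_powMap (hc : IsCommutatorGenerator p c)
    (hpow : ∀ g : G, g ^ p ∈ Subgroup.center G) {k : ℕ} (hk : 2 ≤ k)
    (u : MonoidAlgebra (ZMod p) G) : u ^ p ^ k = powMap (p ^ k) u := by
  obtain ⟨r, hr, -⟩ := exists_pow_char_eq hc hpow u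
  obtain ⟨m, rfl⟩ : ∃ m, k = m + 1 := ⟨k - 1, by omega⟩
  rw [pow_succ', pow_mul, hr, pow_char_pow_add_sumPow_mul hc (by omega) _ _
    (fun g hg => coeff_powMap_eq_zero hpow u hg), powMap_powMap]

end CyclicCommutator
end MonoidAlgebra

/-! ### Normalized units: an upper bound for [Z_2(V), V]. -/

section NormalizedUnits

open MonoidAlgebra

open scoped commutatorElement

variable {p : ℕ} {G : Type*} [Group G] {c : G}

theorem augmentation_single (g : G) (a : ZMod p) :
    augmentation (ZMod p) G (single g a) = a := by
  simp [augmentation]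

/-- A normalized unit as an element of the group algebra. -/
noncomputable def unitVal : normalizedUnits (ZMod p) G →* MonoidAlgebra (ZMod p) G :=
  (Units.coeHom _).comp (Subgroup.subtype _)

theorem augmentation_unitVal (v : normalizedUnits (ZMod p) G) :
    augmentation (ZMod p) G (unitVal v) = 1 := by
  rw [augmentation_apply]
  exact mem_normalizedUnits.1 v.2

theorem normalizedUnits_ext {v w : normalizedUnits (ZMod p) G}
    (h : unitVal v = unitVal w) : v = w :=
  Subtype.ext (Units.ext h)

theorem commutator_mul_mul (u v : normalizedUnits (ZMod p) G) :
    unitVal ⁅u, v⁆ *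
      (unitVal v *
        unitVal u) =
      unitVal u *
        unitVal v := by
  rw [← map_mul, ← map_mul, ← map_mul, commutatorElement_def]
  congr 1
  group

variable [hp : Fact p.Prime]

/-- The normalized units congruent to `1` modulo the annihilator of `c - 1`. -/
noncomputable def annihilatorUnits (p : ℕ) {G : Type*} [Group G] (c : G) :
    Subgroup (normalizedUnits (ZMod p) G) where
  carrier := {v | subOne p c * (unitVal v - 1) = 0}
  one_mem' := by simp
  mul_mem' {a b} ha hb := by
    simp only [Set.mem_ofPred_eq, mul_sub, mul_one, sub_eq_zero, map_mul] at *
    rw [← mul_assoc, ha, hb]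
  inv_mem' {a} ha := by
    simp only [Set.mem_ofPred_eq, mul_sub, mul_one, sub_eq_zero] at *
    conv_lhs => rw [← ha]
    rw [mul_assoc, ← map_mul, mul_inv_cancel, map_one, mul_one]

theorem exists_normalizedUnit_of_isUnit {u : MonoidAlgebra (ZMod p) G} (h : IsUnit u)
    (hu : augmentation (ZMod p) G u = 1) :
    ∃ v : normalizedUnits (ZMod p) G, unitVal v = u := by
  obtain ⟨w, rfl⟩ := h
  exact ⟨⟨w, mem_normalizedUnits.2 (by rwa [← augmentation_apply])⟩, rfl⟩

theorem exists_pow_eq_one_of_isPGroup [Finite G] (hG : IsPGroup p G) :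
    ∃ k, 2 ≤ k ∧ ∀ g : G, g ^ p ^ k = 1 := by
  obtain ⟨n, hn⟩ := IsPGroup.iff_card.1 hG
  -- The exponent is taken at least 2 so that `pow_char_pow_eq_powMap` applies.
  refine ⟨n + 2, by omega, fun g => ?_⟩
  rw [pow_add, pow_mul, ← hn, pow_card_eq_one', one_pow]

theorem exists_normalizedUnit (hc : IsCommutatorGenerator p c)
    (hpow : ∀ g : G, g ^ p ∈ Subgroup.center G) [Finite G] (hG : IsPGroup p G)
    {u : MonoidAlgebra (ZMod p) G} (hu : augmentation (ZMod p) G u = 1) :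
    ∃ v : normalizedUnits (ZMod p) G, unitVal v = u := by
  obtain ⟨k, hk, hk1⟩ := exists_pow_eq_one_of_isPGroup hG
  refine exists_normalizedUnit_of_isUnit ?_ hu
  refine IsUnit.of_pow_eq_one (n := p ^ k) ?_ (pow_ne_zero _ hp.out.ne_zero)
  rw [pow_char_pow_eq_powMap hc hpow hk, powMap_eq_of_forall_pow_eq_one fun g _ => hk1 g, hu,
    map_one]

theorem exists_normalizedUnit_single (g : G) :
    ∃ v : normalizedUnits (ZMod p) G,
      unitVal v = single g 1 :=
  exists_normalizedUnit_of_isUnit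
    ((Group.isUnit g).map (MonoidAlgebra.of (ZMod p) G)) (augmentation_single g 1)

theorem mem_center_normalizedUnits {v : normalizedUnits (ZMod p) G} :
    v ∈ Subgroup.center (normalizedUnits (ZMod p) G) ↔
      ∀ y, Commute (unitVal v) y := by
  rw [Subgroup.mem_center_iff]
  constructor
  · intro h y
    refine (commute_of_forall_single (fun g => ?_) y).symm
    obtain ⟨w, hw⟩ := exists_normalizedUnit_single (p := p) g
    rw [← hw]
    have := congrArg unitVal (h w)
    rwa [map_mul, map_mul] at this
  · intro h w
    refine normalizedUnits_ext ?_
    rw [map_mul, map_mul]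
    exact (h (unitVal w)).eq.symm

/-- The commutator of the second center with the whole group. -/
def secondCenterCommutator (V : Type*) [Group V] : Subgroup V :=
  ⁅Subgroup.upperCentralSeries V 2, (⊤ : Subgroup V)⁆

theorem mem_upperCentralSeries_two {V : Type*} [Group V] {u : V} :
    u ∈ Subgroup.upperCentralSeries V 2 ↔ ∀ v, ⁅u, v⁆ ∈ Subgroup.center V := by
  rw [← Subgroup.upperCentralSeries_one, Subgroup.mem_upperCentralSeries_succ_iff]

/-- The commutators z1 and z2 of v with g and with (1 + g)/2 are central. Additivity in the second
argument yields 1 - z2 = (z2 - z1) g, and comparing supports after multiplication by c - 1 forces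
both sides to vanish. -/
theorem subOne_mul_commutator_single (hp2 : p ≠ 2) (hc : IsCommutatorGenerator p c)
    (hpow : ∀ g : G, g ^ p ∈ Subgroup.center G) [Finite G] (hG : IsPGroup p G)
    {v : normalizedUnits (ZMod p) G}
    (hv : v ∈ Subgroup.upperCentralSeries (normalizedUnits (ZMod p) G) 2) (g : G) :
    subOne p c * (unitVal v * single g 1 -
      single g 1 * unitVal v) = 0 := by
  by_cases hg : g ∈ Subgroup.center G
  · rw [(commute_single_center hg 1 _).eq, sub_self, mul_zero]
  rw [mem_upperCentralSeries_two] at hv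
  have h2 : (2 : ZMod p) ≠ 0 := by
    intro h
    have := (ZMod.natCast_eq_zero_iff 2 p).1 (by exact_mod_cast h)
    exact hp2 ((Nat.prime_dvd_prime_iff_eq hp.out Nat.prime_two).1 this)
  obtain ⟨v1, h1⟩ := exists_normalizedUnit_single (p := p) g
  -- Halving makes 1 + g normalized; this needs p odd.
  obtain ⟨v2, h2'⟩ := exists_normalizedUnit hc hpow hG
    (u := (2 : ZMod p)⁻¹ • (1 + single g 1)) (by
      rw [map_smul, map_add, map_one, augmentation_single, smul_eq_mul, one_add_one_eq_two,
        inv_mul_cancel₀ h2])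
  have e1 := commutator_mul_mul v v1
  have e2 := commutator_mul_mul v v2
  have c1 := mem_center_normalizedUnits.1 (hv v1)
  have c2 := mem_center_normalizedUnits.1 (hv v2)
  rw [h1] at e1
  rw [h2'] at e2
  set z1 := unitVal ⁅v, v1⁆
  set z2 := unitVal ⁅v, v2⁆
  set u := unitVal v with hu
  have e3 : z2 * ((1 + single g 1) * u) = u * (1 + single g 1) := by
    have := congrArg (fun x => (2 : ZMod p) • x) e2
    simpa only [smul_mul_assoc, mul_smul_comm, smul_smul, mul_inv_cancel₀ h2, one_smul] using this
  have e4 : (1 - z2) * u = (z2 - z1) * single g 1 * u := by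
    simp only [mul_add, add_mul, sub_mul, one_mul, mul_one, mul_assoc] at e3 ⊢
    rw [e1, sub_eq_sub_iff_add_eq_add, add_comm _ (z2 * u), e3]
  have e5 : 1 - z2 = (z2 - z1) * single g 1 := by
    have := congrArg (fun x => x * unitVal v⁻¹) e4
    simpa only [mul_assoc, hu, ← map_mul, mul_inv_cancel, map_one, mul_one] using this
  -- After multiplication by c - 1 the left side of `e5` is supported on Z(G), and the right side on
  -- Z(G)g, which is disjoint from Z(G).
  have hz : subOne p c * (1 - z2) = 0 := by
    ext z
    by_cases hz : z ∈ Subgroup.center G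
    · rw [e5, ← mul_assoc, coeff_mul_single_apply, mul_one]
      refine coeff_subOne_mul_of_commute hc (fun y => (c2 y).sub_left (c1 y)) fun h => hg ?_
      rw [Subgroup.mul_mem_cancel_left _ hz] at h
      exact inv_mem_iff.1 h
    · exact coeff_subOne_mul_of_commute hc (fun y => (Commute.one_left y).sub_left (c2 y)) hz
  have hz' : subOne p c * (z2 - z1) = 0 := by
    rw [e5, ← mul_assoc] at hz
    have := congrArg (fun x => x * single g⁻¹ (1 : ZMod p)) hz
    simpa [mul_assoc, single_mul_single, ← one_def] using this
  have hz1 : subOne p c * (z1 - 1) = 0 := by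
    have : z1 - 1 = - (1 - z2) - (z2 - z1) := by abel
    rw [this, mul_sub, mul_neg, hz, hz']
    simp
  rw [← e1, ← sub_one_mul, ← mul_assoc, hz1, zero_mul]

theorem secondCenterCommutator_le (hp2 : p ≠ 2) (hc : IsCommutatorGenerator p c)
    (hpow : ∀ g : G, g ^ p ∈ Subgroup.center G) [Finite G] (hG : IsPGroup p G) :
    secondCenterCommutator (normalizedUnits (ZMod p) G) ≤ annihilatorUnits p c := by
  refine Subgroup.commutator_le.2 fun v hv w _ => ?_
  have key : ∀ y : MonoidAlgebra (ZMod p) G, subOne p c *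
      (unitVal v * y -
        y * unitVal v) = 0 := by
    intro y
    induction y using MonoidAlgebra.induction_on with
    | of g => exact subOne_mul_commutator_single hp2 hc hpow hG hv g
    | add a b ha hb => rw [mul_add, add_mul, add_sub_add_comm, mul_add, ha, hb, add_zero]
    | smul r a ha => rw [mul_smul_comm, smul_mul_assoc, ← smul_sub, mul_smul_comm, ha, smul_zero]
  have h := key (unitVal w)
  rw [← commutator_mul_mul, ← sub_one_mul, ← mul_assoc] at h
  have h' := congrArg (fun x => x * unitVal (w * v)⁻¹) h
  rw [zero_mul, ← map_mul, mul_assoc, ← map_mul, mul_inv_cancel, map_one, mul_one] at h'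
  exact h'

end NormalizedUnits

/-! ### Elements of [Z_2(V), V], and the two exponents. -/

section NormalizedUnits

open MonoidAlgebra

open scoped commutatorElement

variable {p : ℕ} [hp : Fact p.Prime] {G : Type*} [Group G] {c : G}

theorem ZMod.two_ne_zero_of_ne_two (hp2 : p ≠ 2) : (2 : ZMod p) ≠ 0 := by
  intro h
  have := (ZMod.natCast_eq_zero_iff 2 p).1 (by exact_mod_cast h)
  exact hp2 ((Nat.prime_dvd_prime_iff_eq hp.out Nat.prime_two).1 this)

theorem sum_range_natCast_eq_zero (hp2 : p ≠ 2) :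
    ∑ i ∈ Finset.range p, (i : ZMod p) = 0 := by
  have h : (∑ i ∈ Finset.range p, (i : ZMod p)) * 2 = 0 := by
    have := congrArg (Nat.cast : ℕ → ZMod p) (Finset.sum_range_id_mul_two p)
    push_cast at this
    rw [this, CharP.cast_eq_zero, zero_mul]
  exact (mul_eq_zero.1 h).resolve_right (ZMod.two_ne_zero_of_ne_two hp2)

theorem augmentation_sumPow : augmentation (ZMod p) G (sumPow p c) = 0 := by
  simp [sumPow, augmentation_single]

theorem augmentation_sumMulPow (hp2 : p ≠ 2) :
    augmentation (ZMod p) G (sumMulPow p c) = 0 := by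
  simp [sumMulPow, augmentation_single, sum_range_natCast_eq_zero hp2]

/-- Multiplication by N turns each c^i into 1, leaving (0 + 1 + ⋯ + (p-1)) N, and the sum is 0
modulo p for odd p. -/
theorem sumPow_mul_sumMulPow (hp2 : p ≠ 2) (hc : IsCommutatorGenerator p c) :
    sumPow p c * sumMulPow p c = 0 := by
  have h : ∀ i ∈ Finset.range p, sumPow p c * single (c ^ i) (i : ZMod p) =
      (i : ZMod p) • sumPow p c := by
    intro i _
    have : (single (c ^ i) (i : ZMod p) : MonoidAlgebra (ZMod p) G) =
        (i : ZMod p) • single (c ^ i) 1 := by simp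
    rw [this, mul_smul_comm, (sumPow_commute hc _).eq, single_pow_mul_sumPow hc]
  rw [sumMulPow, Finset.mul_sum, Finset.sum_congr rfl h, ← Finset.sum_smul,
    sum_range_natCast_eq_zero hp2, zero_smul]

/-- Commutators of the algebra are multiples of c - 1, and N kills c - 1. -/
theorem sumPow_mul_central (hc : IsCommutatorGenerator p c) (x y : MonoidAlgebra (ZMod p) G) :
    Commute (sumPow p c * x) y := by
  obtain ⟨s, hs⟩ := subOne_dvd_commutator hc x y
  have h : sumPow p c * (x * y - y * x) = 0 := by
    rw [hs, ← mul_assoc, ← (subOne_commute hc _).eq, subOne_mul_sumPow hc, zero_mul]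
  rw [mul_sub, sub_eq_zero] at h
  rw [commute_iff_eq, mul_assoc, h, ← mul_assoc, (sumPow_commute hc y).eq, mul_assoc]

/-- The units `1 + q x` with `(c - 1) q = -(1 + c + ⋯)` lie in the second center. -/
theorem mem_upperCentralSeries_two_of_eq (hc : IsCommutatorGenerator p c)
    {u : normalizedUnits (ZMod p) G} {x : MonoidAlgebra (ZMod p) G}
    (hu : unitVal u = 1 + sumMulPow p c * x) :
    u ∈ Subgroup.upperCentralSeries (normalizedUnits (ZMod p) G) 2 := by
  rw [mem_upperCentralSeries_two]
  intro v
  rw [mem_center_normalizedUnits]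
  obtain ⟨s, hs⟩ := subOne_dvd_commutator hc x (unitVal v)
  have h1 : unitVal u * unitVal v = unitVal v * unitVal u - sumPow p c * s := by
    have : sumMulPow p c * (x * unitVal v - unitVal v * x) = - (sumPow p c * s) := by
      rw [hs, ← mul_assoc, ← (subOne_commute hc _).eq, subOne_mul_sumMulPow hc, neg_mul]
    rw [sub_eq_add_neg, ← this, hu, mul_sub, ← mul_assoc, ← mul_assoc,
      (sumMulPow_commute hc (unitVal v)).eq]
    noncomm_ring
  have h2 : unitVal ⁅u, v⁆ = 1 - sumPow p c * (s * unitVal (v * u)⁻¹) := by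
    have h3 : unitVal ⁅u, v⁆ = unitVal u * unitVal v * unitVal (v * u)⁻¹ := by
      rw [← map_mul, ← map_mul, commutatorElement_def]
      congr 1
      group
    rw [h3, h1, sub_mul, ← map_mul, ← map_mul, mul_inv_cancel, map_one, mul_assoc]
  intro y
  rw [h2]
  exact (Commute.one_left y).sub_left (sumPow_mul_central hc _ y)

/-- This absorbs the error term of a p-th power. With Q = `sumMulPow p c`, a noncentral m and a m
a⁻¹ = cm, the commutator of a with 1 - bQm is 1 + bNm, because Qc = Q - N and NQ = 0. Such factors
multiply by adding their N-parts, since N² = 0. -/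
theorem exists_mem_secondCenterCommutator (hp2 : p ≠ 2) (hc : IsCommutatorGenerator p c)
    (hpow : ∀ g : G, g ^ p ∈ Subgroup.center G) [Finite G] (hG : IsPGroup p G)
    (r : MonoidAlgebra (ZMod p) G) (hr : ∀ g ∈ Subgroup.center G, r.coeff g = 0) :
    ∃ w ∈ secondCenterCommutator (normalizedUnits (ZMod p) G),
      unitVal w = 1 + sumPow p c * r := by
  induction r using MonoidAlgebra.induction with
  | zero => exact ⟨1, one_mem _, by simp⟩
  | single_add m b x hm hb ih =>
    have hmc : m ∉ Subgroup.center G := by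
      intro h
      have := hr m h
      rw [coeff_add, Finsupp.add_apply, Finsupp.notMem_support_iff.1 hm] at this
      simp [hb] at this
    obtain ⟨w, hw, hwx⟩ := ih (by
      intro g hg
      have := hr g hg
      have hne : m ≠ g := by
        rintro rfl
        exact hmc hg
      simpa [Finsupp.single_apply, hne] using this)
    obtain ⟨u, hu⟩ := exists_normalizedUnit hc hpow hG
      (u := 1 + sumMulPow p c * single m (-b)) (by
        rw [map_add, map_one, map_mul, augmentation_sumMulPow hp2, zero_mul, add_zero])
    obtain ⟨a, ha⟩ := exists_conj_eq_mul hc hmc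
    obtain ⟨v, hv⟩ := exists_normalizedUnit_single (p := p) a
    have hu2 := mem_upperCentralSeries_two_of_eq hc hu
    have hvu : ⁅v, u⁆ ∈ secondCenterCommutator (normalizedUnits (ZMod p) G) := by
      rw [secondCenterCommutator, Subgroup.commutator_comm]
      exact Subgroup.commutator_mem_commutator (Subgroup.mem_top v) hu2
    have h1 : unitVal v * unitVal u =
        (1 + sumPow p c * single m b) * (unitVal u * unitVal v) := by
      have e1 : unitVal v * single m (-b) = single c 1 * single m (-b) * unitVal v := by
        rw [hv, single_mul_single, single_mul_single, single_mul_single, ← ha]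
        simp
      have e2 : unitVal v * unitVal u =
          (1 + sumMulPow p c * (single c 1 * single m (-b))) * unitVal v := by
        rw [hu, mul_add, mul_one, ← mul_assoc, ← (sumMulPow_commute hc (unitVal v)).eq, mul_assoc,
          e1, add_mul, one_mul]
        simp only [mul_assoc]
      have e3 : (1 + sumPow p c * single m b) * unitVal u =
          1 + sumMulPow p c * (single c 1 * single m (-b)) := by
        have e4 : sumPow p c * single m b * (sumMulPow p c * single m (-b)) = 0 := by
          rw [mul_assoc, ← mul_assoc (single m b), ← (sumMulPow_commute hc (single m b)).eq,
            mul_assoc, ← mul_assoc, sumPow_mul_sumMulPow hp2 hc, zero_mul]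
        have e5 : sumMulPow p c * single c 1 = sumMulPow p c - sumPow p c := by
          have := subOne_mul_sumMulPow hc (p := p)
          rw [subOne, sub_mul, one_mul] at this
          rw [(sumMulPow_commute hc _).eq, eq_sub_iff_add_eq, ← sub_eq_zero]
          rw [← sub_eq_zero] at this
          rw [← this]
          abel
        rw [hu, add_mul, one_mul, mul_add _ 1, mul_one, e4, ← mul_assoc, e5, sub_mul]
        simp only [single_neg, mul_neg]
        abel
      rw [e2, ← e3, mul_assoc]
    refine ⟨⁅v, u⁆ * w, mul_mem hvu hw, ?_⟩
    have h2 : unitVal ⁅v, u⁆ = 1 + sumPow p c * single m b := by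
      have h3 : unitVal ⁅v, u⁆ = unitVal v * unitVal u * unitVal (u * v)⁻¹ := by
        rw [← map_mul, ← map_mul, commutatorElement_def]
        congr 1
        group
      rw [h3, h1, mul_assoc, ← map_mul, ← map_mul, mul_inv_cancel, map_one, mul_one]
    rw [map_mul, h2, hwx, mul_add, mul_one, add_mul, one_mul, sumPow_mul_mul_sumPow hc, add_zero,
      mul_add]
    abel

/-- For g ≠ 1 the coefficient at 1 of (c - 1)(g - 1) is 1, or 2 if cg = 1; both are nonzero for odd
p. -/
theorem eq_one_of_subOne_mul_single_sub_one (hp2 : p ≠ 2) (hc : IsCommutatorGenerator p c) {g : G}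
    (h : subOne p c * (single g 1 - 1) = 0) : g = 1 := by
  by_contra hg
  have hc1 : c ≠ 1 := by
    rintro rfl
    have := hc.orderOf_eq
    rw [orderOf_one] at this
    exact hp.out.ne_one this.symm
  have h1 := congrArg (fun x => x.coeff 1) h
  by_cases hcg : c * g = 1
  · simp [subOne, mul_sub, sub_mul, single_mul_single, one_def, hg,
      hc1, hcg, one_add_one_eq_two, ZMod.two_ne_zero_of_ne_two hp2] at h1
  · simp [subOne, mul_sub, sub_mul, single_mul_single, one_def, hg,
      hc1, hcg] at h1

/-- The exponent of `G` is the exponent of the quotient of the group of normalized units by the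
commutator of its second center with itself. -/
theorem forall_pow_mem_secondCenterCommutator_iff (hp2 : p ≠ 2) (hc : IsCommutatorGenerator p c)
    (hpow : ∀ g : G, g ^ p ∈ Subgroup.center G) [Finite G] (hG : IsPGroup p G) (n : ℕ) :
    (∀ v : normalizedUnits (ZMod p) G,
      v ^ n ∈ secondCenterCommutator (normalizedUnits (ZMod p) G)) ↔ Monoid.exponent G ∣ n := by
  constructor
  · intro h
    refine Monoid.exponent_dvd_of_forall_pow_eq_one fun g => ?_
    obtain ⟨v, hv⟩ := exists_normalizedUnit_single (p := p) g
    have h1 : subOne p c * (unitVal (v ^ n) - 1) = 0 :=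
      secondCenterCommutator_le hp2 hc hpow hG (h v)
    rw [map_pow, hv, single_pow, one_pow] at h1
    exact eq_one_of_subOne_mul_single_sub_one hp2 hc h1
  · rintro ⟨m, rfl⟩ v
    rw [pow_mul]
    refine pow_mem ?_ m
    obtain ⟨k, hk, hk1⟩ := exists_pow_eq_one_of_isPGroup hG
    obtain ⟨e, -, he⟩ := (Nat.dvd_prime_pow hp.out).1
      (Monoid.exponent_dvd_of_forall_pow_eq_one hk1)
    have hone : powMap (p ^ e) (unitVal v) = 1 := by
      rw [powMap_eq_of_forall_pow_eq_one, augmentation_unitVal, map_one]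
      intro g _
      rw [← he, Monoid.pow_exponent_eq_one]
    rw [he]
    have h0 : e ≠ 0 := by
      rintro rfl
      have := Monoid.order_dvd_exponent c
      rw [hc.orderOf_eq, he, pow_zero, Nat.dvd_one] at this
      exact hp.out.ne_one this
    -- Only for exponent p can the error N r survive; for e ≥ 2 the power v^(p^e) is already 1.
    by_cases h1 : e = 1
    · subst h1
      rw [pow_one] at *
      obtain ⟨r, hr, hr0⟩ := exists_pow_char_eq hc hpow (unitVal v)
      obtain ⟨w, hw, hw1⟩ := exists_mem_secondCenterCommutator hp2 hc hpow hG r hr0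
      have : v ^ p = w := normalizedUnits_ext (by rw [hw1, map_pow, hr, hone])
      rwa [this]
    · have : v ^ p ^ e = 1 := normalizedUnits_ext (by
        rw [map_pow, pow_char_pow_eq_powMap hc hpow (by omega), hone, map_one])
      rw [this]
      exact one_mem _

theorem exponent_center_normalizedUnits (hc : IsCommutatorGenerator p c) [Finite G]
    (hG : IsPGroup p G) :
    Monoid.exponent (Subgroup.center (normalizedUnits (ZMod p) G)) =
      Monoid.exponent (Subgroup.center G) := by
  classical
  refine Nat.dvd_antisymm ?_ ?_
  · refine Monoid.exponent_dvd_of_forall_pow_eq_one fun v => ?_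
    obtain ⟨k, hk, hk1⟩ := exists_pow_eq_one_of_isPGroup (hG.to_subgroup (Subgroup.center G))
    obtain ⟨e, -, he⟩ := (Nat.dvd_prime_pow hp.out).1
      (Monoid.exponent_dvd_of_forall_pow_eq_one hk1)
    have h0 : e ≠ 0 := by
      rintro rfl
      have := Monoid.order_dvd_exponent (⟨c, hc.mem_center⟩ : Subgroup.center G)
      rw [Subgroup.orderOf_mk, hc.orderOf_eq, he, pow_zero, Nat.dvd_one] at this
      exact hp.out.ne_one this
    rw [he]
    refine Subtype.ext (normalizedUnits_ext ?_)
    have hv := mem_center_normalizedUnits.1 v.2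
    set u : MonoidAlgebra (ZMod p) G := unitVal (v : normalizedUnits (ZMod p) G) with hu
    -- A central unit is its part x on Z(G) plus a multiple of N. The latter has augmentation 0 and
    -- disappears in the p^e-th power, as e ≥ 1.
    set x : MonoidAlgebra (ZMod p) G :=
      ofCoeff (u.coeff.filter (fun g => g ∈ Subgroup.center G)) with hx
    have hx0 : ∀ g ∉ Subgroup.center G, x.coeff g = 0 := fun g hg => by
      rw [hx, coeff_ofCoeff, Finsupp.filter_apply_neg _ _ hg]
    obtain ⟨r, hr, -⟩ := exists_eq_sumPow_mul hc (u - x) (subOne_mul_eq_zero_of_commute hc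
      (fun y => (hv y).sub_left (commute_of_coeff_eq_zero hx0 y)) (fun z hz => by
        rw [coeff_sub, Finsupp.sub_apply, hx, coeff_ofCoeff,
          Finsupp.filter_apply_pos (fun g => g ∈ Subgroup.center G) _ hz, sub_self]))
    have hur : u = x + sumPow p c * r := by rw [← hr]; abel
    have haug : augmentation (ZMod p) G x = 1 := by
      rw [← augmentation_unitVal (v : normalizedUnits (ZMod p) G), ← hu, hur, map_add, map_mul,
        augmentation_sumPow, zero_mul, add_zero]
    rw [Subgroup.coe_pow, map_pow, ← hu, hur, pow_char_pow_add_sumPow_mul hc h0 x r hx0,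
      powMap_eq_of_forall_pow_eq_one, haug, map_one, OneMemClass.coe_one, map_one]
    intro g hg
    have hgz : g ∈ Subgroup.center G := by
      by_contra h
      exact hg (hx0 g h)
    have := Monoid.pow_exponent_eq_one (⟨g, hgz⟩ : Subgroup.center G)
    rw [he] at this
    exact congrArg Subtype.val this
  · refine Monoid.exponent_dvd_of_forall_pow_eq_one fun z => ?_
    obtain ⟨v, hv⟩ := exists_normalizedUnit_single (p := p) (z : G)
    have hvc : v ∈ Subgroup.center (normalizedUnits (ZMod p) G) := by
      rw [mem_center_normalizedUnits, hv]
      exact commute_single_center z.2 1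
    have h1 : v ^ Monoid.exponent (Subgroup.center (normalizedUnits (ZMod p) G)) = 1 :=
      congrArg Subtype.val (Monoid.pow_exponent_eq_one
        (⟨v, hvc⟩ : Subgroup.center (normalizedUnits (ZMod p) G)))
    have h2 := congrArg unitVal h1
    rw [map_pow, hv, single_pow, one_pow, map_one, one_def] at h2
    exact Subtype.ext ((single_left_inj one_ne_zero).1 h2)

end NormalizedUnits

/-! ### Counting units and conjugacy classes; invariants recovered from V. -/

section Card

open MonoidAlgebra

variable {p : ℕ} [hp : Fact p.Prime] {G : Type*} [Group G] {c : G}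

/-- A submodule containing `1` has `p` times as many elements as its part of augmentation `1`. -/
theorem card_augmentation_eq_one (S : Submodule (ZMod p) (MonoidAlgebra (ZMod p) G))
    (h1 : (1 : MonoidAlgebra (ZMod p) G) ∈ S) :
    Nat.card S = p * Nat.card {x : MonoidAlgebra (ZMod p) G //
      x ∈ S ∧ augmentation (ZMod p) G x = 1} := by
  have e : S ≃ ZMod p × {x : MonoidAlgebra (ZMod p) G //
      x ∈ S ∧ augmentation (ZMod p) G x = 1} :=
    { toFun := fun x => (augmentation (ZMod p) G x,
        ⟨x - (augmentation (ZMod p) G x - 1) • 1, S.sub_mem x.2 (S.smul_mem _ h1), by simp⟩)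
      invFun := fun y => ⟨y.2.1 + (y.1 - 1) • 1, S.add_mem y.2.2.1 (S.smul_mem _ h1)⟩
      left_inv := fun x => Subtype.ext (by simp)
      right_inv := fun y => by
        obtain ⟨a, x, hx, hx1⟩ := y
        have : augmentation (ZMod p) G (x + (a - 1) • 1) = a := by simp [hx1]
        refine Prod.ext this (Subtype.ext ?_)
        simp only [this]
        abel }
  rw [Nat.card_congr e, Nat.card_prod, Nat.card_zmod]

theorem card_normalizedUnits (hc : IsCommutatorGenerator p c)
    (hpow : ∀ g : G, g ^ p ∈ Subgroup.center G) [Finite G] (hG : IsPGroup p G) :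
    p ^ Nat.card G = p * Nat.card (normalizedUnits (ZMod p) G) := by
  have h1 := card_augmentation_eq_one (p := p) (G := G) ⊤ Submodule.mem_top
  have h2 : Nat.card (⊤ : Submodule (ZMod p) (MonoidAlgebra (ZMod p) G)) = p ^ Nat.card G := by
    rw [Nat.card_congr Submodule.topEquiv.toEquiv, Nat.card_congr (coeffEquiv (R := ZMod p) (M := G)),
      Nat.card_congr (Finsupp.equivFunOnFinite (α := G) (M := ZMod p)), Nat.card_fun, Nat.card_zmod]
  rw [← h2, h1]
  congr 1
  refine (Nat.card_congr (Equiv.ofBijective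
    (fun v : normalizedUnits (ZMod p) G => (⟨unitVal v, Submodule.mem_top, augmentation_unitVal v⟩ :
      {x : MonoidAlgebra (ZMod p) G // x ∈ (⊤ : Submodule (ZMod p) (MonoidAlgebra (ZMod p) G)) ∧
        augmentation (ZMod p) G x = 1})) ⟨?_, ?_⟩)).symm
  · intro v w h
    exact normalizedUnits_ext (congrArg Subtype.val h)
  · rintro ⟨x, -, hx⟩
    obtain ⟨v, hv⟩ := exists_normalizedUnit hc hpow hG hx
    exact ⟨v, Subtype.ext hv⟩

/-- The center of the group algebra consists of the class functions. -/
noncomputable def centerEquivClassFunctions [Finite G] :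
    Subalgebra.toSubmodule (Subalgebra.center (ZMod p) (MonoidAlgebra (ZMod p) G)) ≃
      (ConjClasses G → ZMod p) where
  toFun x := fun k => Quotient.lift (fun g => (x : MonoidAlgebra (ZMod p) G).coeff g)
    (fun a b hab => by
      obtain ⟨d, hd⟩ := isConj_iff.1 hab
      rw [← hd]
      exact (coeff_conj_of_commute (fun y => ((Subalgebra.mem_center_iff (R := ZMod p)).1 x.2 y).symm) d a).symm) k
  invFun f := ⟨ofCoeff (Finsupp.equivFunOnFinite.symm fun g => f (ConjClasses.mk g)), by
    refine (Subalgebra.mem_center_iff (R := ZMod p)).2 fun y => ?_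
    refine commute_of_forall_single (fun g => ?_) y
    ext h
    rw [coeff_single_mul_apply, coeff_mul_single_apply]
    simp only [one_mul, mul_one, Finsupp.equivFunOnFinite_symm_apply_apply]
    congr 1
    exact ConjClasses.mk_eq_mk_iff_isConj.2 (isConj_iff.2 ⟨g, by group⟩)⟩
  left_inv x := Subtype.ext (by ext g; rfl)
  right_inv f := by
    funext k
    induction k using Quotient.inductionOn
    rfl

theorem card_center_normalizedUnits (hc : IsCommutatorGenerator p c)
    (hpow : ∀ g : G, g ^ p ∈ Subgroup.center G) [Finite G] (hG : IsPGroup p G) :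
    p ^ Nat.card (ConjClasses G) =
      p * Nat.card (Subgroup.center (normalizedUnits (ZMod p) G)) := by
  have h1 := card_augmentation_eq_one (p := p) (G := G)
    (Subalgebra.toSubmodule (Subalgebra.center (ZMod p) (MonoidAlgebra (ZMod p) G)))
    (one_mem (Subalgebra.center (ZMod p) (MonoidAlgebra (ZMod p) G)))
  rw [Nat.card_congr centerEquivClassFunctions, Nat.card_fun, Nat.card_zmod] at h1
  rw [h1]
  congr 1
  refine (Nat.card_congr (Equiv.ofBijective
    (fun v : Subgroup.center (normalizedUnits (ZMod p) G) =>
      (⟨unitVal (v : normalizedUnits (ZMod p) G),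
        (Subalgebra.mem_center_iff (R := ZMod p)).2 fun y => ((mem_center_normalizedUnits.1 v.2) y).symm,
        augmentation_unitVal _⟩ :
      {x : MonoidAlgebra (ZMod p) G // x ∈ Subalgebra.toSubmodule
        (Subalgebra.center (ZMod p) (MonoidAlgebra (ZMod p) G)) ∧
        augmentation (ZMod p) G x = 1})) ⟨?_, ?_⟩)).symm
  · intro v w h
    exact Subtype.ext (normalizedUnits_ext (congrArg Subtype.val h))
  · rintro ⟨x, hx, hx1⟩
    obtain ⟨v, hv⟩ := exists_normalizedUnit hc hpow hG hx1
    refine ⟨⟨v, mem_center_normalizedUnits.2 fun y => ?_⟩, Subtype.ext hv⟩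
    rw [hv]
    exact ((Subalgebra.mem_center_iff (R := ZMod p)).1 hx y).symm

/-- Conjugates of g differ from g by powers of c, and iterating `exists_conj_eq_mul` reaches every
element of ⟨c⟩g. -/
theorem ncard_carrier_noncenter (hc : IsCommutatorGenerator p c) {g : G}
    (hg : g ∉ Subgroup.center G) : Nat.card (ConjClasses.mk g).carrier = p := by
  have hs : (ConjClasses.mk g).carrier = (fun z => z * g) '' (Subgroup.zpowers c : Set G) := by
    ext h
    rw [ConjClasses.mem_carrier_iff_mk_eq, ConjClasses.mk_eq_mk_iff_isConj]
    constructor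
    · intro hh
      obtain ⟨d, hd⟩ := isConj_iff.1 hh.symm
      obtain ⟨i, hi⟩ := hc.exists_pow d g
      refine ⟨c ^ i, ⟨i, by simp⟩, ?_⟩
      simp only
      rw [← hd, hi]
      group
    · rintro ⟨_, ⟨i, rfl⟩, rfl⟩
      obtain ⟨a, ha⟩ := exists_conj_eq_mul hc hg
      have : ∀ n : ℕ, IsConj g (c ^ n * g) := by
        intro n
        induction n with
        | zero => rw [pow_zero, one_mul]
        | succ n ih =>
          refine ih.trans (isConj_iff.2 ⟨a, ?_⟩)
          have hcn : a * c ^ n = c ^ n * a :=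
            (Commute.pow_right (show Commute a c from hc.mul_comm a) n).eq
          calc a * (c ^ n * g) * a⁻¹ = c ^ n * (a * g * a⁻¹) := by
                rw [← mul_assoc, hcn]; group
            _ = c ^ (n + 1) * g := by rw [ha, pow_succ, mul_assoc]
      have hfin : IsOfFinOrder c :=
        isOfFinOrder_iff_pow_eq_one.2 ⟨p, hp.out.pos, hc.pow_eq_one⟩
      obtain ⟨n, hn⟩ := hfin.mem_powers_iff_mem_zpowers.2 (⟨i, rfl⟩ : c ^ i ∈ Subgroup.zpowers c)
      simp only at hn ⊢
      rw [← hn]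
      exact (this n).symm
  rw [hs, Nat.card_image_of_injective (mul_left_injective g)]
  rw [← hc.orderOf_eq]
  exact Nat.card_zpowers c

/-- This is the class equation with all noncentral classes of size p. The inequality makes the
truncated subtraction a true one. -/
theorem card_center_add_mul (hc : IsCommutatorGenerator p c) [Finite G] :
    Nat.card (Subgroup.center G) + p * (Nat.card (ConjClasses G) - Nat.card (Subgroup.center G)) =
      Nat.card G ∧ Nat.card (Subgroup.center G) ≤ Nat.card (ConjClasses G) := by
  classical
  have h0 := Group.nat_card_center_add_sum_card_noncenter_eq_card G
  have h1 : Nat.card (Subgroup.center G) = ((ConjClasses.noncenter G)ᶜ).ncard := by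
    rw [← Nat.card_coe_set_eq]
    exact Nat.card_congr ((ConjClasses.mk_bijOn G).equiv _)
  have h2 : (ConjClasses.noncenter G).ncard + ((ConjClasses.noncenter G)ᶜ).ncard =
    Nat.card (ConjClasses G) := Set.ncard_add_ncard_compl _
  have h3 : ∑ᶠ x ∈ ConjClasses.noncenter G, Nat.card x.carrier =
      (ConjClasses.noncenter G).ncard * p := by
    rw [finsum_mem_congr (g := fun _ => p) rfl, finsum_mem_eq_finite_toFinset_sum _ (Set.toFinite _),
      Finset.sum_const, Set.ncard_eq_toFinset_card _ (Set.toFinite _), smul_eq_mul]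
    intro x hx
    induction x using Quotient.inductionOn with
    | h g =>
    refine ncard_carrier_noncenter hc fun hg => ?_
    exact (ConjClasses.mk_bijOn G).mapsTo hg hx
  rw [h3] at h0
  constructor
  · rw [← h0, ← h2, h1, Nat.add_sub_cancel, mul_comm]
  · omega

theorem secondCenterCommutator_map {V W : Type*} [Group V] [Group W] (e : V ≃* W) {v : V}
    (hv : v ∈ secondCenterCommutator V) : e v ∈ secondCenterCommutator W := by
  have h1 : (secondCenterCommutator V).map e.toMonoidHom ≤ secondCenterCommutator W := by
    rw [secondCenterCommutator, Subgroup.map_commutator]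
    exact Subgroup.commutator_mono (Subgroup.upperCentralSeries.map e.surjective 2) le_top
  exact h1 ⟨v, hv, rfl⟩

theorem card_center_eq_of_mulEquiv {V W : Type*} [Group V] [Group W] (e : V ≃* W) :
    Nat.card (Subgroup.center V) = Nat.card (Subgroup.center W) ∧
      Monoid.exponent (Subgroup.center V) = Monoid.exponent (Subgroup.center W) :=
  ⟨Nat.card_congr (Subgroup.centerCongr e).toEquiv,
    Monoid.exponent_eq_of_mulEquiv (Subgroup.centerCongr e)⟩

theorem invariants_of_mulEquiv_normalizedUnits (hp2 : p ≠ 2) {H : Type*} [Group H] {d : H}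
    (hc : IsCommutatorGenerator p c) (hpow : ∀ g : G, g ^ p ∈ Subgroup.center G) [Finite G]
    (hG : IsPGroup p G)
    (hd : IsCommutatorGenerator p d) (hpow' : ∀ g : H, g ^ p ∈ Subgroup.center H) [Finite H]
    (hH : IsPGroup p H) (e : normalizedUnits (ZMod p) G ≃* normalizedUnits (ZMod p) H) :
    Nat.card G = Nat.card H ∧
      Nat.card (Subgroup.center G) = Nat.card (Subgroup.center H) ∧
      Monoid.exponent (Subgroup.center G) = Monoid.exponent (Subgroup.center H) ∧
      Monoid.exponent G = Monoid.exponent H := by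
  have hcard : Nat.card G = Nat.card H := by
    refine Nat.pow_right_injective hp.out.two_le ?_
    simp only
    rw [card_normalizedUnits hc hpow hG, card_normalizedUnits hd hpow' hH, Nat.card_congr e.toEquiv]
  have hk : Nat.card (ConjClasses G) = Nat.card (ConjClasses H) := by
    refine Nat.pow_right_injective hp.out.two_le ?_
    simp only
    rw [card_center_normalizedUnits hc hpow hG, card_center_normalizedUnits hd hpow' hH,
      (card_center_eq_of_mulEquiv e).1]
  refine ⟨hcard, ?_, ?_, ?_⟩
  · obtain ⟨h1, h2⟩ := card_center_add_mul hc
    obtain ⟨h3, h4⟩ := card_center_add_mul hd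
    rw [← hk] at h3 h4
    rw [hcard, ← h3] at h1
    zify [h2, h4] at h1
    have hp1 : (p : ℤ) - 1 ≠ 0 := by
      have := hp.out.two_le
      omega
    -- The class equation reads (p - 1)|Z| = p k - |G|, with equal |G| and equal class number k on
    -- both sides.
    have : ((p : ℤ) - 1) * ((Nat.card (Subgroup.center G) : ℤ) - Nat.card (Subgroup.center H)) = 0 := by
      linear_combination -h1
    have := (mul_eq_zero.1 this).resolve_left hp1
    omega
  · rw [← exponent_center_normalizedUnits hc hG, ← exponent_center_normalizedUnits hd hH,
      (card_center_eq_of_mulEquiv e).2]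
  -- The subgroup [Z_2(V), V] is carried along by any isomorphism, so divisibility by the exponent
  -- can be read off from V.
  · have key : ∀ n, Monoid.exponent G ∣ n ↔ Monoid.exponent H ∣ n := by
      intro n
      rw [← forall_pow_mem_secondCenterCommutator_iff hp2 hc hpow hG,
        ← forall_pow_mem_secondCenterCommutator_iff hp2 hd hpow' hH]
      constructor
      · intro h v
        have := secondCenterCommutator_map e (h (e.symm v))
        simpa using this
      · intro h v
        have := secondCenterCommutator_map e.symm (h (e v))
        simpa using this
    exact Nat.dvd_antisymm ((key _).2 dvd_rfl) ((key _).1 dvd_rfl)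

theorem nonempty_mulEquiv_normalizedUnits (R : Type*) [CommRing R]
    {G H : Type*} [Group G] [Group H] (e : G ≃* H) :
    Nonempty (normalizedUnits R G ≃* normalizedUnits R H) := by
  let f : MonoidAlgebra R G ≃* MonoidAlgebra R H := (mapDomainRingEquiv R e).toMulEquiv
  have hf : ∀ x, augmentation R H (f x) = augmentation R G x := by
    intro x
    induction x using MonoidAlgebra.induction_linear with
    | zero => simp [f]
    | add x y hx hy =>
      have : f (x + y) = f x + f y := map_add (mapDomainRingEquiv R e) x y
      rw [this, map_add, map_add, hx, hy]
    | single g r =>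
      have : f (single g r) = single (e g) r := mapDomainRingEquiv_single e r g
      rw [this]
      simp [augmentation]
  refine ⟨(Subgroup.equivMapOfInjective (normalizedUnits R G) (Units.mapEquiv f).toMonoidHom
    (Units.mapEquiv f).injective).trans (MulEquiv.subgroupCongr ?_)⟩
  ext u
  constructor
  · rintro ⟨v, hv, rfl⟩
    rw [mem_normalizedUnits, ← augmentation_apply]
    have := mem_normalizedUnits.1 hv
    rw [← augmentation_apply] at this
    exact (hf _).trans this
  · intro hu
    refine ⟨(Units.mapEquiv f).symm u, ?_, (Units.mapEquiv f).apply_symm_apply u⟩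
    have := mem_normalizedUnits.1 hu
    rw [← augmentation_apply] at this
    refine mem_normalizedUnits.2 ?_
    rw [← augmentation_apply, ← hf]
    simpa using this

end Card

/-! ### Structure of p-groups with cyclic Frattini subgroup, p odd. -/

section CyclicFrattini

open scoped commutatorElement

/-- A finite cyclic group has one subgroup of each order: a^i generates the same subgroup as
a^gcd(|a|, i). -/
theorem mem_zpowers_of_orderOf_dvd {G : Type*} [Group G] [Finite G] {a x y : G}
    (hx : x ∈ Subgroup.zpowers a) (hy : y ∈ Subgroup.zpowers a) (h : orderOf y ∣ orderOf x) :
    y ∈ Subgroup.zpowers x := by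
  obtain ⟨i, rfl⟩ := (mem_powers_iff_mem_zpowers).2 hx
  obtain ⟨j, rfl⟩ := (mem_powers_iff_mem_zpowers).2 hy
  simp only at h ⊢
  have hN := orderOf_pos a
  have hg0 : 0 < (orderOf a).gcd i := Nat.gcd_pos_of_pos_left _ hN
  obtain ⟨m, hm⟩ := Nat.gcd_dvd_left (orderOf a) i
  have hm0 : 0 < m := by
    rcases Nat.eq_zero_or_pos m with rfl | h
    · rw [mul_zero] at hm; omega
    · exact h
  have hox : orderOf (a ^ i) = m := by
    rw [orderOf_pow]
    exact Nat.div_eq_of_eq_mul_right hg0 hm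
  have h1 : (orderOf a).gcd i ∣ j := by
    have : (a ^ j) ^ m = 1 := by
      rw [← orderOf_dvd_iff_pow_eq_one, ← hox]; exact h
    rw [← pow_mul, ← orderOf_dvd_iff_pow_eq_one, hm] at this
    exact Nat.dvd_of_mul_dvd_mul_right hm0 this
  obtain ⟨k, rfl⟩ := h1
  have hb : a ^ (orderOf a).gcd i = (a ^ i) ^ ((orderOf a).gcdB i) := by
    have := Nat.gcd_eq_gcd_ab (orderOf a) i
    rw [← zpow_natCast, this, zpow_add, zpow_mul, zpow_natCast, pow_orderOf_eq_one, one_zpow,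
      one_mul, zpow_mul, zpow_natCast]
  rw [pow_mul, hb]
  exact pow_mem (zpow_mem (Subgroup.mem_zpowers _) _) _

variable {p : ℕ} [hp : Fact p.Prime] {G : Type*} [Group G]

/-- A maximal subgroup of a finite p-group is normal of index p: a subgroup p times larger
containing it must be everything. The quotient is therefore cyclic of order p. -/
theorem pow_mem_and_commutator_mem_of_isCoatom [Finite G] (hG : IsPGroup p G) {M : Subgroup G}
    (hM : IsCoatom M) : (∀ g : G, g ^ p ∈ M) ∧ ∀ g h : G, ⁅g, h⁆ ∈ M := by
  have hnil := hG.isNilpotent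
  have hN : M.Normal := Subgroup.NormalizerCondition.normal_of_coatom M
    (Group.normalizerCondition_of_isNilpotent) hM
  obtain ⟨n, hn⟩ := IsPGroup.iff_card.1 hG
  obtain ⟨m, hm⟩ := IsPGroup.iff_card.1 (hG.to_subgroup M)
  have hlt : m < n := by
    have h1 : Nat.card M < Nat.card G := by
      refine lt_of_le_of_ne (Nat.card_le_card_of_injective _ Subtype.val_injective) fun h => ?_
      exact hM.1 (Subgroup.eq_top_of_card_eq M h)
    rw [hn, hm] at h1
    exact (Nat.pow_lt_pow_iff_right hp.out.one_lt).1 h1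
  obtain ⟨K, hK, hMK⟩ := Sylow.exists_subgroup_card_pow_succ (G := G) (p := p) (n := m)
    (by rw [hn]; exact pow_dvd_pow _ hlt) hm
  have hKtop : K = ⊤ := by
    refine hM.2 K (lt_of_le_of_ne hMK fun h => ?_)
    rw [← h, hm] at hK
    exact absurd ((Nat.pow_right_injective hp.out.two_le) hK) (by omega)
  have hind : Nat.card (G ⧸ M) = p := by
    have h1 := Subgroup.card_mul_index M
    have h2 : Nat.card G = p ^ (m + 1) := by rw [← hK, hKtop, Subgroup.card_top]
    rw [hm, h2, pow_succ] at h1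
    exact Nat.eq_of_mul_eq_mul_left (pow_pos hp.out.pos m) h1
  have hcyc : IsCyclic (G ⧸ M) := isCyclic_of_prime_card hind
  have hcomm : ∀ x y : G ⧸ M, x * y = y * x := hcyc.isMulCommutative.is_comm.comm
  constructor
  · intro g
    rw [← QuotientGroup.eq_one_iff, QuotientGroup.mk_pow, ← hind, pow_card_eq_one']
  · intro g h
    rw [← QuotientGroup.eq_one_iff, commutatorElement_def]
    simp only [QuotientGroup.mk_mul, QuotientGroup.mk_inv]
    rw [hcomm (g : G ⧸ M) h]
    group

theorem pow_mem_frattini [Finite G] (hG : IsPGroup p G) (g : G) : g ^ p ∈ frattini G := by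
  rw [frattini, Order.radical, Subgroup.mem_iInf]
  intro M
  rw [Subgroup.mem_iInf]
  exact fun hM => (pow_mem_and_commutator_mem_of_isCoatom hG hM).1 g

theorem commutatorElement_mem_frattini [Finite G] (hG : IsPGroup p G) (g h : G) :
    ⁅g, h⁆ ∈ frattini G := by
  rw [frattini, Order.radical, Subgroup.mem_iInf]
  intro M
  rw [Subgroup.mem_iInf]
  exact fun hM => (pow_mem_and_commutator_mem_of_isCoatom hG hM).2 g h

/-- Fermat gives p ∣ i; lifting the exponent for odd p then says that (1 + i)^p - 1 has the p-adic
valuation of p i. -/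
theorem Int.pow_dvd_prime_mul_of_pow_dvd (hp2 : p ≠ 2) {n : ℕ} (hn : n ≠ 0) {i : ℤ}
    (h : (p : ℤ) ^ n ∣ (1 + i) ^ p - 1) : (p : ℤ) ^ n ∣ p * i ∧ (p : ℤ) ∣ i := by
  have hpi : (p : ℤ) ∣ i := by
    have h1 : (p : ℤ) ∣ (1 + i) ^ p - 1 := (dvd_pow_self _ hn).trans h
    rw [← ZMod.intCast_zmod_eq_zero_iff_dvd] at h1 ⊢
    push_cast at h1
    rw [ZMod.pow_card] at h1
    simpa using h1
  refine ⟨?_, hpi⟩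
  have hp' : Prime (p : ℤ) := Nat.prime_iff_prime_int.1 hp.out
  have h2 : ¬ (p : ℤ) ∣ 1 + i := fun hd => hp'.not_isUnit (isUnit_of_dvd_one
    ((dvd_add_left hpi).1 hd))
  have h3 := Int.emultiplicity_pow_sub_pow hp.out (hp.out.odd_of_ne_two hp2)
    (x := 1 + i) (y := 1) (by simpa using hpi) h2 p
  rw [pow_dvd_iff_le_emultiplicity, emultiplicity_mul hp']
  rw [pow_dvd_iff_le_emultiplicity] at h
  rw [one_pow, add_sub_cancel_left, ← Int.natCast_emultiplicity p p] at h3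
  rw [add_comm, ← h3]
  exact h

theorem mul_pow_eq_of_commutator {g d z : G} (h2 : g * d = z * d * g) (hz : ∀ y, y * z = z * y)
    (n : ℕ) : (d * g) ^ n = z ^ (n.choose 2) * d ^ n * g ^ n := by
  have hzn : ∀ (n : ℕ) (y : G), y * z ^ n = z ^ n * y := fun n y =>
    (Commute.pow_right (show Commute y z from hz y) n).eq
  have hgd : ∀ n : ℕ, g ^ n * d = z ^ n * d * g ^ n := by
    intro n
    induction n with
    | zero => simp
    | succ n ih =>
      calc g ^ (n + 1) * d = g ^ n * (g * d) := by rw [pow_succ, mul_assoc]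
        _ = g ^ n * z * d * g := by rw [h2]; group
        _ = z * (g ^ n * d) * g := by rw [hz]; group
        _ = z ^ (n + 1) * d * g ^ (n + 1) := by rw [ih, pow_succ' z, pow_succ g]; group
  induction n with
  | zero => simp
  | succ n ih =>
    calc (d * g) ^ (n + 1) = z ^ (n.choose 2) * d ^ n * (g ^ n * d) * g := by
          rw [pow_succ, ih]; group
      _ = z ^ (n.choose 2) * (d ^ n * z ^ n) * d * g ^ n * g := by rw [hgd]; group
      _ = z ^ (n.choose 2 + n) * d ^ n * d * g ^ n * g := by rw [hzn, pow_add]; group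
      _ = z ^ ((n + 1).choose 2) * d ^ (n + 1) * g ^ (n + 1) := by
        rw [Nat.choose_succ_succ' n 1, Nat.choose_one_right, add_comm n, pow_succ d, pow_succ g]
        simp only [mul_assoc]

theorem mul_pow_prime_eq_of_commutator (hp2 : p ≠ 2) {g d z : G} (h2 : g * d = z * d * g)
    (hz : ∀ y, y * z = z * y) (hzp : z ^ p = 1) : (d * g) ^ p = d ^ p * g ^ p := by
  obtain ⟨k, hk⟩ : p ∣ p.choose 2 := hp.out.dvd_choose_self two_ne_zero (by
    have := hp.out.two_le
    omega)
  rw [mul_pow_eq_of_commutator h2 hz, hk, pow_mul, hzp, one_pow, one_mul]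

theorem conj_pow_prime_eq (hp2 : p ≠ 2) {x g d z : G} (h1 : x * g = d * g * x)
    (h2 : g * d = z * d * g) (hz : ∀ y, y * z = z * y) (hzp : z ^ p = 1) :
    x * g ^ p = d ^ p * g ^ p * x := by
  have hx : ∀ n : ℕ, x * g ^ n = (d * g) ^ n * x := by
    intro n
    induction n with
    | zero => simp
    | succ n ih => rw [pow_succ, ← mul_assoc, ih, mul_assoc, h1, pow_succ]; group
  rw [hx, mul_pow_prime_eq_of_commutator hp2 h2 hz hzp]

/-- If all commutators and `p`-th powers lie in a cyclic subgroup, then `p`-th powers are central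
and commutators are central of order dividing `p`. -/
theorem pow_mem_center_of_cyclic (hp2 : p ≠ 2) [Finite G] (hG : IsPGroup p G) {a : G}
    (hcomm : ∀ g h : G, ⁅g, h⁆ ∈ Subgroup.zpowers a) (hpow : ∀ g : G, g ^ p ∈ Subgroup.zpowers a) :
    (∀ g : G, g ^ p ∈ Subgroup.center G) ∧
      ∀ g h : G, ⁅g, h⁆ ^ p = 1 ∧ ⁅g, h⁆ ∈ Subgroup.center G := by
  obtain ⟨n, hn⟩ := (IsPGroup.iff_orderOf.1 hG) a
  -- Conjugation by g is the power map 1 + i on ⟨a⟩. As g^p lies in ⟨a⟩, its p-th iterate is trivial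
  -- there, so a^(p i) = 1 and p ∣ i (or a = 1).
  have hact : ∀ g : G, ∃ i : ℤ, g * a * g⁻¹ = a ^ (1 + i) ∧ a ^ ((p : ℤ) * i) = 1 ∧
      ∀ y ∈ Subgroup.zpowers a, y ^ p = 1 → y ^ i = 1 := by
    intro g
    obtain ⟨i, hi⟩ := hcomm g a
    simp only [commutatorElement_def] at hi
    have h1 : g * a * g⁻¹ = a ^ (1 + i) := by
      rw [add_comm, zpow_add, hi, zpow_one]
      group
    by_cases hn0 : n = 0
    · subst hn0
      rw [pow_zero, orderOf_eq_one_iff] at hn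
      subst hn
      refine ⟨i, h1, one_zpow _, ?_⟩
      rintro y ⟨k, rfl⟩ -
      simp
    have h2 : ∀ m : ℕ, g ^ m * a * (g ^ m)⁻¹ = a ^ ((1 + i) ^ m) := by
      intro m
      induction m with
      | zero => simp
      | succ m ih =>
        have e1 : ∀ k : ℤ, g * a ^ k * g⁻¹ = (g * a * g⁻¹) ^ k := fun k => (conj_zpow).symm
        calc g ^ (m + 1) * a * (g ^ (m + 1))⁻¹ = g * (g ^ m * a * (g ^ m)⁻¹) * g⁻¹ := by
              rw [pow_succ']; group
          _ = a ^ ((1 + i) ^ (m + 1)) := by rw [ih, e1, h1, ← zpow_mul, pow_succ']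
    obtain ⟨k, hk⟩ := hpow g
    have h3 : a ^ ((1 + i) ^ p - 1) = 1 := by
      rw [zpow_sub, ← h2, ← hk]
      simp only
      group
    rw [← orderOf_dvd_iff_zpow_eq_one, hn] at h3
    push_cast at h3
    obtain ⟨h4, j, rfl⟩ := Int.pow_dvd_prime_mul_of_pow_dvd hp2 hn0 h3
    refine ⟨_, h1, ?_, fun y _ hyp => ?_⟩
    · rw [← orderOf_dvd_iff_zpow_eq_one, hn]
      exact_mod_cast h4
    · rw [zpow_mul, zpow_natCast, hyp, one_zpow]
  have hconj : ∀ (g : G) (i : ℤ), g * a * g⁻¹ = a ^ (1 + i) →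
      ∀ y ∈ Subgroup.zpowers a, g * y * g⁻¹ = y ^ i * y := by
    rintro g i h1 _ ⟨k, rfl⟩
    simp only
    rw [← conj_zpow, h1, ← zpow_mul, ← zpow_mul, ← zpow_add]
    congr 1
    ring
  have hcent : ∀ y ∈ Subgroup.zpowers a, y ^ p = 1 → y ∈ Subgroup.center G := by
    intro y hy hyp
    rw [Subgroup.mem_center_iff]
    intro g
    obtain ⟨i, h1, -, h3⟩ := hact g
    have := hconj g i h1 y hy
    rw [h3 y hy hyp, one_mul, mul_inv_eq_iff_eq_mul] at this
    exact this
  have hcomp : ∀ (g y : G), y ∈ Subgroup.zpowers a → ⁅g, y⁆ ^ p = 1 := by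
    rintro g _ ⟨k, rfl⟩
    obtain ⟨i, h1, h2, -⟩ := hact g
    simp only
    rw [commutatorElement_def, hconj g i h1 _ ⟨k, rfl⟩, mul_inv_cancel_right, ← zpow_mul,
      ← zpow_natCast, ← zpow_mul, show k * i * (p : ℤ) = p * i * k by ring, zpow_mul, h2, one_zpow]
  have hcc : ∀ (g y : G), y ∈ Subgroup.zpowers a → ⁅g, y⁆ ∈ Subgroup.center G := fun g y hy =>
    hcent _ (hcomm g y) (hcomp g y hy)
  -- Since [g, [x, g]] is central of order dividing p, the p-th power of [x, g]g splits.
  have key : ∀ x g : G, x * g ^ p = ⁅x, g⁆ ^ p * g ^ p * x := by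
    intro x g
    refine conj_pow_prime_eq hp2 (z := ⁅g, ⁅x, g⁆⁆) ?_ ?_ (fun y => ?_) (hcomp _ _ (hcomm x g))
    · rw [commutatorElement_def x g]; group
    · rw [commutatorElement_def g]; group
    · exact Subgroup.mem_center_iff.1 (hcc g _ (hcomm x g)) y
  have hinv : ∀ x g : G, ⁅g, x⁆ ^ p = (⁅x, g⁆ ^ p)⁻¹ := by
    intro x g
    rw [← commutatorElement_inv, inv_pow]
  have hone : ∀ x g : G, ⁅x, g⁆ ^ p = 1 := by
    intro x g
    -- If g centralizes ⟨a⟩, it commutes with x^p, and `key` with the roles exchanged finishes.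
    by_cases hga : g * a = a * g
    · obtain ⟨k, hk⟩ := hpow x
      have h1 := key g x
      have h2 : g * x ^ p = x ^ p * g := by
        rw [← hk]
        exact (Commute.zpow_right (show Commute g a from hga) k).eq
      rw [h2, mul_assoc] at h1
      have h3 : ⁅g, x⁆ ^ p = 1 := by
        simpa using h1
      rw [hinv, h3, inv_one]
    · have ha : a ∈ Subgroup.zpowers a := Subgroup.mem_zpowers a
      have hω : orderOf ⁅g, a⁆ = p := orderOf_eq_prime (hcomp g a ha) fun h =>
        hga (commutatorElement_eq_one_iff_mul_comm.1 h)
      obtain ⟨j, hj⟩ : ⁅x, a⁆ ∈ Subgroup.zpowers ⁅g, a⁆ := by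
        refine mem_zpowers_of_orderOf_dvd (hcomm g a) (hcomm x a) ?_
        rw [hω]
        exact orderOf_dvd_of_pow_eq_one (hcomp x a ha)
      have hz : ∀ (y : G) (k : ℤ), y * a ^ k = ⁅y, a⁆ ^ k * a ^ k * y := by
        intro y k
        have hc := Subgroup.mem_center_iff.1 (hcc y a ha)
        have h1 : y * a * y⁻¹ = ⁅y, a⁆ * a := by rw [commutatorElement_def]; group
        have h2 : y * a ^ k * y⁻¹ = (⁅y, a⁆ * a) ^ k := by rw [← h1]; exact conj_zpow.symm
        rw [Commute.mul_zpow (show Commute ⁅y, a⁆ a from (hc a).symm), mul_inv_eq_iff_eq_mul] at h2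
        exact h2
      -- Write g^p = a^k. Since g commutes with a^k, [g, a]^k = 1; as [x, a] is a power of [g, a],
      -- also x commutes with g^p.
      obtain ⟨k, hk⟩ := hpow g
      simp only at hk hj
      have h1 : ⁅g, a⁆ ^ k = 1 := by
        have h2 := hz g k
        have h3 : g * a ^ k = a ^ k * g := by rw [hk, ← pow_succ, ← pow_succ']
        rw [h3, mul_assoc] at h2
        simpa using h2
      have h4 := key x g
      rw [← hk, hz x k, ← hj, ← zpow_mul, mul_comm j k, zpow_mul, h1, one_zpow] at h4
      simpa using h4.symm
  refine ⟨fun g => Subgroup.mem_center_iff.2 fun x => ?_, fun g h =>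
    ⟨hone g h, hcent _ (hcomm g h) (hone g h)⟩⟩
  rw [key, hone, one_mul]

/-- Structure of the nonabelian `p`-groups with cyclic Frattini subgroup for odd `p`. -/
theorem exists_isCommutatorGenerator (hp2 : p ≠ 2) [Finite G] (hG : IsPGroup p G)
    (hna : ∃ a b : G, a * b ≠ b * a) (hΦ : IsCyclic (frattini G)) :
    ∃ a c : G, IsCommutatorGenerator p c ∧ (∀ g : G, g ^ p ∈ Subgroup.center G) ∧
      c ∈ Subgroup.zpowers a ∧ ∀ g : G, g ^ p ∈ Subgroup.zpowers a := by
  obtain ⟨⟨a, ha⟩, hgen⟩ := hΦ.exists_generator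
  have hle : ∀ y ∈ frattini G, y ∈ Subgroup.zpowers a := by
    intro y hy
    obtain ⟨k, hk⟩ := hgen ⟨y, hy⟩
    exact ⟨k, congrArg Subtype.val hk⟩
  have hcomm : ∀ g h : G, ⁅g, h⁆ ∈ Subgroup.zpowers a := fun g h =>
    hle _ (commutatorElement_mem_frattini hG g h)
  have hpow : ∀ g : G, g ^ p ∈ Subgroup.zpowers a := fun g => hle _ (pow_mem_frattini hG g)
  obtain ⟨h1, h2⟩ := pow_mem_center_of_cyclic hp2 hG hcomm hpow
  obtain ⟨x, y, hxy⟩ := hna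
  have hord : orderOf ⁅x, y⁆ = p := orderOf_eq_prime (h2 x y).1 fun h =>
    hxy (commutatorElement_eq_one_iff_mul_comm.1 h)
  refine ⟨a, ⁅x, y⁆, ⟨(h2 x y).2, hord, fun g h => ?_⟩, h1, hcomm x y, hpow⟩
  have h3 : ⁅g, h⁆ ∈ Subgroup.zpowers ⁅x, y⁆ :=
    mem_zpowers_of_orderOf_dvd (hcomm x y) (hcomm g h) (by
      rw [hord]; exact orderOf_dvd_of_pow_eq_one (h2 g h).1)
  obtain ⟨i, hi⟩ := mem_powers_iff_mem_zpowers.2 h3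
  simp only at hi
  refine ⟨i, ?_⟩
  rw [hi, commutatorElement_def g h]
  group

end CyclicFrattini

/-! ### Partial isomorphisms as subgroups of a product. -/

section PartialIso

/-- A subgroup meeting both factors trivially is the graph of an isomorphism between its
projections. -/
theorem nonempty_mulEquiv_of_subgroup_prod {G H : Type*} [Group G] [Group H] [Finite G] [Finite H]
    (hcard : Nat.card G = Nat.card H) (K : Subgroup (G × H))
    (h1 : ∀ k ∈ K, k.1 = 1 → k = 1) (h2 : ∀ k ∈ K, k.2 = 1 → k = 1)
    (htop : K.map (MonoidHom.fst G H) = ⊤) :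
    ∃ e : G ≃* H, ∀ g, (g, e g) ∈ K := by
  have hex : ∀ g : G, ∃ h : H, (g, h) ∈ K := by
    intro g
    have : g ∈ K.map (MonoidHom.fst G H) := htop ▸ Subgroup.mem_top g
    obtain ⟨⟨a, b⟩, hk, rfl⟩ := this
    exact ⟨b, hk⟩
  choose f hf using hex
  have huniq : ∀ g h, (g, h) ∈ K → h = f g := by
    intro g h hgh
    have h3 := h1 _ (mul_mem hgh (inv_mem (hf g))) (by simp)
    have h4 := congrArg Prod.snd h3
    simpa [mul_inv_eq_one] using h4
  let F : G →* H := MonoidHom.mk' f fun a b =>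
    (huniq _ _ (by simpa using mul_mem (hf a) (hf b))).symm
  have hinj : Function.Injective F := by
    rw [injective_iff_map_eq_one]
    intro g hg
    have hg' : f g = 1 := hg
    exact congrArg Prod.fst (h2 _ (hf g) hg')
  have hbij : Function.Bijective F := (Nat.bijective_iff_injective_and_card F).2 ⟨hinj, hcard⟩
  exact ⟨MulEquiv.ofBijective F hbij, hf⟩

theorem nonempty_mulEquiv_of_subgroup_prod_snd {G H : Type*} [Group G] [Group H] [Finite G]
    [Finite H] (hcard : Nat.card G = Nat.card H) (K : Subgroup (G × H))
    (h1 : ∀ k ∈ K, k.1 = 1 → k = 1) (h2 : ∀ k ∈ K, k.2 = 1 → k = 1)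
    (htop : K.map (MonoidHom.snd G H) = ⊤) : Nonempty (G ≃* H) := by
  obtain ⟨e, -⟩ := nonempty_mulEquiv_of_subgroup_prod hcard.symm
    (K.map (MulEquiv.prodComm : G × H ≃* H × G).toMonoidHom)
    (by
      rintro _ ⟨k, hk, rfl⟩ h
      have := h2 k hk h
      rw [this, map_one])
    (by
      rintro _ ⟨k, hk, rfl⟩ h
      have := h1 k hk h
      rw [this, map_one])
    (by
      rw [Subgroup.map_map, ← htop]
      rfl)
  exact ⟨e.symm⟩

theorem card_map_eq_of_injOn {P Q : Type*} [Group P] [Group Q] (φ : P →* Q) (K : Subgroup P)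
    (h : ∀ k ∈ K, φ k = 1 → k = 1) : Nat.card (K.map φ) = Nat.card K := by
  have hinj : Function.Injective (φ.subgroupMap K) := by
    rw [injective_iff_map_eq_one]
    intro k hk
    exact Subtype.ext (h k k.2 (congrArg Subtype.val hk))
  exact (Nat.card_congr (Equiv.ofBijective _ ⟨hinj, φ.subgroupMap_surjective K⟩)).symm

/-- If z lies outside D and z^p = b^(p i), then z b^(-i) is also outside D and has trivial p-th
power. -/
theorem exists_notMem_pow_eq_one {p : ℕ} {A : Type*} [CommGroup A] {b : A} {D : Subgroup A}
    (hb : b ∈ D) (hA : ∀ z : A, z ^ p ∈ Subgroup.zpowers (b ^ p)) (hD : D ≠ ⊤) :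
    ∃ x ∉ D, x ^ p = 1 := by
  by_contra! h
  refine hD (eq_top_iff.2 fun z _ => ?_)
  obtain ⟨i, hi⟩ := hA z
  simp only at hi
  have h1 : (z * (b ^ i)⁻¹) ^ p = 1 := by
    rw [mul_pow, ← hi, inv_pow, ← zpow_natCast (b ^ i), ← zpow_mul, mul_comm i, zpow_mul,
      zpow_natCast, mul_inv_cancel]
  by_contra hz
  refine h _ (fun h2 => hz ?_) h1
  exact (Subgroup.mul_mem_cancel_right D (inv_mem (zpow_mem hb i))).1 h2

theorem mem_of_zpow_mem_of_pow_eq_one {p : ℕ} [hp : Fact p.Prime] {A : Type*} [Group A]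
    {D : Subgroup A} {x : A} (hx : x ^ p = 1) {i : ℤ} (hi : ¬ (p : ℤ) ∣ i) (h : x ^ i ∈ D) :
    x ∈ D := by
  have hcop : IsCoprime i (p : ℤ) :=
    ((Prime.coprime_iff_not_dvd (Nat.prime_iff_prime_int.1 hp.out)).2 hi).symm
  obtain ⟨u, v, huv⟩ := hcop
  have : x = (x ^ i) ^ u := by
    rw [← zpow_mul, mul_comm, ← zpow_one x, ← zpow_mul, one_mul, ← huv, zpow_add, mul_comm v,
      zpow_mul x p, zpow_natCast, hx, one_zpow, mul_one]
  rw [this]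
  exact zpow_mem h u

/-- Two finite abelian groups of the same order in which `p`-th powers are powers of `b ^ p`, with
`b` of the same order in both, are isomorphic by an isomorphism respecting `b`. -/
theorem exists_mulEquiv_of_pow_mem_zpowers {p : ℕ} [hp : Fact p.Prime] {A B : Type*} [CommGroup A]
    [CommGroup B] [Finite A] [Finite B] (hcard : Nat.card A = Nat.card B) {a : A} {b : B}
    (hab : orderOf a = orderOf b) (hA : ∀ z : A, z ^ p ∈ Subgroup.zpowers (a ^ p))
    (hB : ∀ z : B, z ^ p ∈ Subgroup.zpowers (b ^ p)) : ∃ e : A ≃* B, e a = b := by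
  let S : Set (Subgroup (A × B)) :=
    {K | (a, b) ∈ K ∧ (∀ k ∈ K, k.1 = 1 → k = 1) ∧ ∀ k ∈ K, k.2 = 1 → k = 1}
  have h0 : Subgroup.zpowers (a, b) ∈ S := by
    refine ⟨Subgroup.mem_zpowers _, ?_, ?_⟩
    · rintro _ ⟨i, rfl⟩ h
      have h1 : a ^ i = 1 := h
      have h2 : b ^ i = 1 := by
        rwa [← orderOf_dvd_iff_zpow_eq_one, ← hab, orderOf_dvd_iff_zpow_eq_one]
      exact Prod.ext h1 h2
    · rintro _ ⟨i, rfl⟩ h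
      have h1 : b ^ i = 1 := h
      have h2 : a ^ i = 1 := by
        rwa [← orderOf_dvd_iff_zpow_eq_one, hab, orderOf_dvd_iff_zpow_eq_one]
      exact Prod.ext h2 h1
  obtain ⟨K, -, hK⟩ := (Set.toFinite S).exists_le_maximal h0
  obtain ⟨hKab, hK1, hK2⟩ := hK.prop
  have hc1 := card_map_eq_of_injOn (MonoidHom.fst A B) K hK1
  have hc2 := card_map_eq_of_injOn (MonoidHom.snd A B) K hK2
  have htop : K.map (MonoidHom.fst A B) = ⊤ := by
    by_contra hne
    have hne' : K.map (MonoidHom.snd A B) ≠ ⊤ := by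
      intro h
      refine hne (Subgroup.eq_top_of_card_eq _ ?_)
      rw [hc1, ← hc2, h, Subgroup.card_top, hcard]
    obtain ⟨x, hx, hxp⟩ := exists_notMem_pow_eq_one (b := a)
      (Subgroup.mem_map.2 ⟨(a, b), hKab, rfl⟩) hA hne
    obtain ⟨y, hy, hyp⟩ := exists_notMem_pow_eq_one (b := b)
      (Subgroup.mem_map.2 ⟨(a, b), hKab, rfl⟩) hB hne'
    have hxy : ((x, y) : A × B) ^ p = 1 := Prod.ext hxp hyp
    have hdvd : ∀ i : ℤ, (p : ℤ) ∣ i → ((x, y) : A × B) ^ i = 1 := by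
      rintro _ ⟨j, rfl⟩
      rw [zpow_mul, zpow_natCast, hxy, one_zpow]
    -- If x^i lies in the domain then p ∣ i, and (x, y)^i = 1; likewise for y. So adjoining (x, y)
    -- still gives a partial isomorphism.
    have hS : K ⊔ Subgroup.zpowers (x, y) ∈ S := by
      refine ⟨Subgroup.mem_sup_left hKab, ?_, ?_⟩
      · intro w hw hw1
        obtain ⟨k, hk, _, ⟨i, rfl⟩, rfl⟩ := Subgroup.mem_sup.1 hw
        have hi : (p : ℤ) ∣ i := by
          by_contra hi
          refine hx (mem_of_zpow_mem_of_pow_eq_one hxp hi ⟨k⁻¹, inv_mem hk, ?_⟩)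
          exact inv_eq_of_mul_eq_one_right hw1
        simp only at hw1 ⊢
        rw [hdvd i hi, mul_one] at hw1 ⊢
        exact hK1 k hk hw1
      · intro w hw hw1
        obtain ⟨k, hk, _, ⟨i, rfl⟩, rfl⟩ := Subgroup.mem_sup.1 hw
        have hi : (p : ℤ) ∣ i := by
          by_contra hi
          refine hy (mem_of_zpow_mem_of_pow_eq_one hyp hi ⟨k⁻¹, inv_mem hk, ?_⟩)
          exact inv_eq_of_mul_eq_one_right hw1
        simp only at hw1 ⊢
        rw [hdvd i hi, mul_one] at hw1 ⊢
        exact hK2 k hk hw1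
    have hle := hK.le_of_ge hS le_sup_left
    exact hx ⟨(x, y), hle (Subgroup.mem_sup_right (Subgroup.mem_zpowers _)), rfl⟩
  obtain ⟨e, he⟩ := nonempty_mulEquiv_of_subgroup_prod hcard K hK1 hK2 htop
  refine ⟨e, ?_⟩
  have h3 := hK1 _ (mul_mem hKab (inv_mem (he a))) (by simp)
  have h4 := congrArg Prod.snd h3
  exact (mul_inv_eq_one.1 h4).symm

end PartialIso

/-! ### Central factors and hyperbolic pairs. -/

section HyperbolicExtension

theorem zpow_mul_zpow_of_commutator {P : Type*} [Group P] {C X Y : P} (h : X * Y = C * Y * X)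
    (hX : Commute C X) (hY : Commute C Y) (i j : ℤ) :
    X ^ i * Y ^ j = C ^ (i * j) * Y ^ j * X ^ i := by
  have h1 : X * Y ^ j * X⁻¹ = C ^ j * Y ^ j := by
    have h2 : X * Y * X⁻¹ = C * Y := by rw [h]; group
    have h3 : X * Y ^ j * X⁻¹ = (X * Y * X⁻¹) ^ j := conj_zpow.symm
    rw [h3, h2, hY.mul_zpow]
  have h4 : (Y ^ j)⁻¹ * X * Y ^ j = C ^ j * X := by
    have h5 : X * Y ^ j = C ^ j * Y ^ j * X := by rw [← h1]; group
    have h6 : C ^ j * Y ^ j = Y ^ j * C ^ j := (hY.zpow_zpow j j).eq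
    rw [mul_assoc, h5, h6]
    group
  have h7 : (Y ^ j)⁻¹ * X ^ i * Y ^ j = C ^ (i * j) * X ^ i := by
    have h8 : (Y ^ j)⁻¹ * X ^ i * Y ^ j = ((Y ^ j)⁻¹ * X * Y ^ j) ^ i := by
      have := conj_zpow (i := i) (a := (Y ^ j)⁻¹) (b := X)
      rw [inv_inv] at this
      exact this.symm
    rw [h8, h4, (hX.zpow_left j).mul_zpow, ← zpow_mul, mul_comm j]
  have h9 : C ^ (i * j) * Y ^ j = Y ^ j * C ^ (i * j) := (hY.zpow_zpow _ j).eq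
  rw [h9, mul_assoc, ← h7]
  group

variable {p : ℕ} [hp : Fact p.Prime] {G : Type*} [Group G] {c : G}

omit hp in
/-- If `x` and `y` have commutator `c`, then `x ^ i` commutes with `y` only if `p ∣ i`. -/
theorem IsCommutatorGenerator.dvd_of_commute_zpow (hc : IsCommutatorGenerator p c) {x y : G}
    (hxy : x * y = c * y * x) {i : ℤ} (h : Commute (x ^ i) y) : (p : ℤ) ∣ i := by
  have h1 := zpow_mul_zpow_of_commutator hxy (hc.commute x) (hc.commute y) i 1
  rw [zpow_one, mul_one, h.eq, mul_assoc] at h1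
  rw [← hc.zpow_eq_one_iff]
  simpa using h1

omit hp in
theorem IsCommutatorGenerator.dvd_of_commute_zpow_right (hc : IsCommutatorGenerator p c) {x y : G}
    (hxy : x * y = c * y * x) {i : ℤ} (h : Commute x (y ^ i)) : (p : ℤ) ∣ i := by
  have h1 := zpow_mul_zpow_of_commutator hxy (hc.commute x) (hc.commute y) 1 i
  rw [zpow_one, one_mul, h.eq, mul_assoc] at h1
  rw [← hc.zpow_eq_one_iff]
  simpa using h1

/-- A suitable power of a noncommuting pair has commutator `c`. -/
theorem IsCommutatorGenerator.exists_zpow_mul_eq (hc : IsCommutatorGenerator p c) {x y : G}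
    (hxy : x * y ≠ y * x) : ∃ m : ℤ, x * y ^ m = c * y ^ m * x := by
  obtain ⟨r, hr⟩ := hc.exists_pow x y
  have hr0 : ¬ (p : ℤ) ∣ r := by
    intro h
    have h1 := hc.zpow_eq_one_iff.2 h
    rw [zpow_natCast] at h1
    rw [h1, one_mul] at hr
    exact hxy hr
  obtain ⟨u, v, huv⟩ := (Prime.coprime_iff_not_dvd (Nat.prime_iff_prime_int.1 hp.out)).2 hr0
  refine ⟨v, ?_⟩
  rw [← mul_assoc] at hr
  have h1 := zpow_mul_zpow_of_commutator hr ((hc.commute x).pow_left r)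
    ((hc.commute y).pow_left r) 1 v
  rw [zpow_one, one_mul] at h1
  rw [h1, ← zpow_natCast, ← zpow_mul, _root_.mul_comm (r : ℤ) v,
    show v * (r : ℤ) = 1 - u * p by linear_combination huv,
    zpow_sub, zpow_one, hc.zpow_eq_one_iff.2 (dvd_mul_left _ _), inv_one, mul_one]

/-- The commutator enters with exponent p choose 2, a multiple of p for odd p. -/
theorem IsCommutatorGenerator.mul_pow_prime (hp2 : p ≠ 2) (hc : IsCommutatorGenerator p c) (x y : G) :
    (x * y) ^ p = x ^ p * y ^ p := by
  obtain ⟨r, hr⟩ := hc.exists_pow y x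
  rw [← mul_assoc] at hr
  refine mul_pow_prime_eq_of_commutator hp2 hr (fun g => ?_) ?_
  · exact ((hc.commute g).pow_left r).symm.eq
  · rw [← pow_mul, _root_.mul_comm, pow_mul, hc.pow_eq_one, one_pow]

/-- The elements whose `p`-th power is the `p`-th power of a central element. -/
def centralPowSubgroup (hp2 : p ≠ 2) (hc : IsCommutatorGenerator p c) : Subgroup G where
  carrier := {g | ∃ z ∈ Subgroup.center G, g ^ p = z ^ p}
  one_mem' := ⟨1, one_mem _, rfl⟩
  mul_mem' := by
    rintro x y ⟨z, hz, hxz⟩ ⟨w, hw, hyw⟩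
    exact ⟨z * w, mul_mem hz hw, by rw [hc.mul_pow_prime hp2, hc.mul_pow_prime hp2, hxz, hyw]⟩
  inv_mem' := by
    rintro x ⟨z, hz, hxz⟩
    exact ⟨z⁻¹, inv_mem hz, by rw [inv_pow, inv_pow, hxz]⟩

theorem mem_centralPowSubgroup_of_pow_eq_one {hp2 : p ≠ 2} {hc : IsCommutatorGenerator p c} {g : G}
    (h : g ^ p = 1) : g ∈ centralPowSubgroup hp2 hc := ⟨1, one_mem _, by rw [h, one_pow]⟩

theorem center_le_centralPowSubgroup {hp2 : p ≠ 2} {hc : IsCommutatorGenerator p c} :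
    Subgroup.center G ≤ centralPowSubgroup hp2 hc := fun _ hz => ⟨_, hz, rfl⟩

/-- A subgroup containing the center that generates the group together with its centralizer. -/
structure IsCentralFactor {G : Type*} [Group G] (D : Subgroup G) : Prop where
  center_le : Subgroup.center G ≤ D
  exists_mul : ∀ g : G, ∃ u ∈ D, ∃ e ∈ Subgroup.centralizer (D : Set G), g = u * e

theorem isCentralFactor_center {G : Type*} [Group G] : IsCentralFactor (Subgroup.center G) where
  center_le := le_rfl
  exists_mul g := ⟨1, one_mem _, g, fun _ hz => (Subgroup.mem_center_iff.1 hz g).symm,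
    (one_mul g).symm⟩

theorem IsCentralFactor.mem_center {D : Subgroup G} (hD : IsCentralFactor D) {e : G}
    (he : e ∈ Subgroup.centralizer (D : Set G))
    (h : ∀ f ∈ Subgroup.centralizer (D : Set G), Commute e f) : e ∈ Subgroup.center G := by
  rw [Subgroup.mem_center_iff]
  intro g
  obtain ⟨u, hu, f, hf, rfl⟩ := hD.exists_mul g
  exact ((show Commute u e from he u hu).mul_left (h f hf).symm).eq

theorem IsCentralFactor.eq_top {D : Subgroup G} (hD : IsCentralFactor D)
    (h : ∀ e ∈ Subgroup.centralizer (D : Set G), e ∈ Subgroup.center G) : D = ⊤ := by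
  refine eq_top_iff.2 fun g _ => ?_
  obtain ⟨u, hu, e, he, rfl⟩ := hD.exists_mul g
  exact mul_mem hu (hD.center_le (h e he))

omit hp in
-- This is orthogonal projection in the symplectic space G/Z(G): a hyperbolic pair in the orthogonal
-- complement of D splits off.
theorem IsCentralFactor.extend (hc : IsCommutatorGenerator p c) {D D' : Subgroup G}
    (hD : IsCentralFactor D) {x y : G} (hx : x ∈ Subgroup.centralizer (D : Set G))
    (hy : y ∈ Subgroup.centralizer (D : Set G)) (hxy : x * y = c * y * x)
    (hle : D ≤ D') (hxD : x ∈ D') (hyD : y ∈ D')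
    (hD' : ∀ w ∈ D', ∃ i j : ℤ, ∃ u ∈ D, w = x ^ i * y ^ j * u) : IsCentralFactor D' where
  center_le := hD.center_le.trans hle
  exists_mul g := by
    obtain ⟨u, hu, e, he, rfl⟩ := hD.exists_mul g
    obtain ⟨r, hr⟩ := hc.exists_pow e x
    obtain ⟨s, hs⟩ := hc.exists_pow e y
    rw [← zpow_natCast] at hr hs
    -- This t has the same commutators with x and y as e, so t⁻¹ e centralizes both.
    set t := x ^ (s : ℤ) * y ^ (-(r : ℤ)) with ht
    have htD : t ∈ Subgroup.centralizer (D : Set G) := mul_mem (zpow_mem hx _) (zpow_mem hy _)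
    have htx : t * x = c ^ (r : ℤ) * (x * t) := by
      have h1 := zpow_mul_zpow_of_commutator hxy (hc.commute x) (hc.commute y) 1 (-(r : ℤ))
      rw [zpow_one, one_mul] at h1
      have h2 : y ^ (-(r : ℤ)) * x = c ^ (r : ℤ) * (x * y ^ (-(r : ℤ))) := by
        rw [h1, mul_assoc (c ^ (-(r : ℤ))), ← mul_assoc, ← zpow_add, add_neg_cancel, zpow_zero,
          one_mul]
      have h3 : x ^ (s : ℤ) * c ^ (r : ℤ) = c ^ (r : ℤ) * x ^ (s : ℤ) :=
        ((hc.commute x).zpow_zpow _ _).symm.eq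
      have h4 : x ^ (s : ℤ) * x = x * x ^ (s : ℤ) := (Commute.refl x).zpow_left _ |>.eq
      rw [ht, mul_assoc, h2, ← mul_assoc, h3, mul_assoc, ← mul_assoc _ x, h4, mul_assoc]
    have hty : t * y = c ^ (s : ℤ) * (y * t) := by
      have h1 := zpow_mul_zpow_of_commutator hxy (hc.commute x) (hc.commute y) (s : ℤ) 1
      rw [zpow_one, mul_one] at h1
      have h4 : y ^ (-(r : ℤ)) * y = y * y ^ (-(r : ℤ)) := (Commute.refl y).zpow_left _ |>.eq
      rw [ht, mul_assoc, h4, ← mul_assoc, h1]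
      simp only [mul_assoc]
    have hcomm : ∀ v : G, ∀ k : ℤ, t * v = c ^ k * (v * t) → e * v = c ^ k * (v * e) →
        Commute v (t⁻¹ * e) := by
      intro v k h1 h2
      have h3 : c ^ k * (v * t) * (t⁻¹ * e) = c ^ k * (v * e) := by group
      rw [commute_iff_eq]
      calc v * (t⁻¹ * e) = t⁻¹ * (c ^ k)⁻¹ * (c ^ k * (t * v * t⁻¹)) * e := by
            have : t⁻¹ * (c ^ k)⁻¹ * (c ^ k * (t * v * t⁻¹)) * e = v * (t⁻¹ * e) := by group
            exact this.symm
        _ = t⁻¹ * (t * v * t⁻¹) * e := by group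
        _ = t⁻¹ * (c ^ k * v) * e := by rw [h1]; group
        _ = t⁻¹ * (e * v) := by rw [h2]; group
        _ = t⁻¹ * e * v := by group
    refine ⟨u * t, mul_mem (hle hu) (mul_mem (zpow_mem hxD _) (zpow_mem hyD _)), t⁻¹ * e, ?_,
      by group⟩
    intro w hw
    obtain ⟨i, j, u', hu', rfl⟩ := hD' w hw
    have hu'e : Commute u' (t⁻¹ * e) := (mul_mem (inv_mem htD) he : t⁻¹ * e ∈ _) u' hu'
    have hxe : Commute x (t⁻¹ * e) := hcomm x r htx hr
    have hye : Commute y (t⁻¹ * e) := hcomm y s hty hs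
    exact ((hxe.zpow_left i).mul_left (hye.zpow_left j)).mul_left hu'e

/-- The subgroup of all `X ^ i * Y ^ j * k`, `k ∈ K`, for `X` and `Y` centralizing `K` with
commutator in `K`. -/
def adjoinPair {P : Type*} [Group P] (K : Subgroup P) {C X Y : P} (hC : C ∈ K)
    (hX : X ∈ Subgroup.centralizer (K : Set P)) (hY : Y ∈ Subgroup.centralizer (K : Set P))
    (h : X * Y = C * Y * X) : Subgroup P where
  carrier := {w | ∃ i j : ℤ, ∃ k ∈ K, w = X ^ i * Y ^ j * k}
  one_mem' := ⟨0, 0, 1, one_mem _, by simp⟩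
  mul_mem' := by
    rintro _ _ ⟨i, j, k, hk, rfl⟩ ⟨i', j', k', hk', rfl⟩
    -- Moving Y^j past X^i' costs the factor C^(-(i' j)).
    refine ⟨i + i', j + j', C ^ (-(i' * j)) * (k * k'),
      mul_mem (zpow_mem hC _) (mul_mem hk hk'), ?_⟩
    have hCX : Commute C X := hX C hC
    have hCY : Commute C Y := hY C hC
    have h1 := zpow_mul_zpow_of_commutator h hCX hCY i' j
    have h2 : Y ^ j * X ^ i' = X ^ i' * Y ^ j * C ^ (-(i' * j)) := by
      have h3 : Commute (C ^ (-(i' * j))) (X ^ i' * Y ^ j) :=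
        (hCX.zpow_zpow _ _).mul_right (hCY.zpow_zpow _ _)
      rw [← h3.eq, h1, mul_assoc (C ^ (i' * j)), ← mul_assoc, ← zpow_add, neg_add_cancel,
        zpow_zero, one_mul]
    have h4 : k * (X ^ i' * Y ^ j') = X ^ i' * Y ^ j' * k :=
      (((show Commute k X from hX k hk).zpow_right i').mul_right
        ((show Commute k Y from hY k hk).zpow_right j')).eq
    have h5 : C ^ (-(i' * j)) * Y ^ j' = Y ^ j' * C ^ (-(i' * j)) := (hCY.zpow_zpow _ _).eq
    calc X ^ i * Y ^ j * k * (X ^ i' * Y ^ j' * k')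
        = X ^ i * Y ^ j * (k * (X ^ i' * Y ^ j')) * k' := by group
      _ = X ^ i * (Y ^ j * X ^ i') * Y ^ j' * (k * k') := by rw [h4]; group
      _ = X ^ i * X ^ i' * Y ^ j * (C ^ (-(i' * j)) * Y ^ j') * (k * k') := by rw [h2]; group
      _ = X ^ (i + i') * Y ^ (j + j') * (C ^ (-(i' * j)) * (k * k')) := by
        rw [h5, zpow_add, zpow_add]; simp only [mul_assoc]
  inv_mem' := by
    rintro _ ⟨i, j, k, hk, rfl⟩
    have hCX : Commute C X := hX C hC
    have hCY : Commute C Y := hY C hC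
    have h1 := zpow_mul_zpow_of_commutator h hCX hCY (-i) (-j)
    have h3 : Commute (C ^ (-(-i * -j))) (X ^ (-i) * Y ^ (-j)) :=
      (hCX.zpow_zpow _ _).mul_right (hCY.zpow_zpow _ _)
    have h2 : Y ^ (-j) * X ^ (-i) = X ^ (-i) * Y ^ (-j) * C ^ (-(-i * -j)) := by
      rw [← h3.eq, h1, mul_assoc (C ^ (-i * -j)), ← mul_assoc, ← zpow_add, neg_add_cancel,
        zpow_zero, one_mul]
    refine ⟨-i, -j, C ^ (-(-i * -j)) * k⁻¹, mul_mem (zpow_mem hC _) (inv_mem hk), ?_⟩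
    have h4 : Commute k⁻¹ (Y ^ (-j) * X ^ (-i)) :=
      (((show Commute k Y from hY k hk).zpow_right _).mul_right
        ((show Commute k X from hX k hk).zpow_right _)).inv_left
    rw [mul_inv_rev, mul_inv_rev, ← zpow_neg, ← zpow_neg, h4.eq, h2]
    simp only [mul_assoc]

omit hp in
-- Used to keep the projections injective after adjoining a pair. If the image is 1, then φ X^i
-- commutes with φ Y, and φ Y^j with φ X. Both exponents are thus multiples of p, and X^p, Y^p lie
-- in K.
theorem mem_of_map_eq_one_of_mem_adjoinPair {P : Type*} [Group P] {K : Subgroup P} {C X Y : P}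
    (φ : P →* G) (hc : IsCommutatorGenerator p (φ C))
    (hX : X ∈ Subgroup.centralizer (K : Set P)) (hY : Y ∈ Subgroup.centralizer (K : Set P))
    (h : X * Y = C * Y * X) (hXp : X ^ p ∈ K) (hYp : Y ^ p ∈ K) {i j : ℤ} {k : P} (hk : k ∈ K)
    (hw : φ (X ^ i * Y ^ j * k) = 1) : X ^ i * Y ^ j * k ∈ K := by
  have hφ : φ X * φ Y = φ C * φ Y * φ X := by rw [← map_mul, h, map_mul, map_mul]
  have hkX : Commute (φ k) (φ X) := (show Commute k X from hX k hk).map φ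
  have hkY : Commute (φ k) (φ Y) := (show Commute k Y from hY k hk).map φ
  rw [map_mul, map_mul, map_zpow, map_zpow] at hw
  have hi : (p : ℤ) ∣ i := by
    refine hc.dvd_of_commute_zpow hφ ?_
    have : φ X ^ i = (φ Y ^ j * φ k)⁻¹ := by rw [eq_inv_iff_mul_eq_one, ← mul_assoc, hw]
    rw [this]
    exact (((Commute.refl (φ Y)).zpow_left j).mul_left hkY).inv_left
  have hj : (p : ℤ) ∣ j := by
    refine hc.dvd_of_commute_zpow_right hφ ?_
    have : φ Y ^ j = (φ k * φ X ^ i)⁻¹ := by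
      rw [eq_inv_iff_mul_eq_one, ← mul_assoc]
      rw [mul_assoc] at hw
      exact mul_eq_one_iff_eq_inv.2 (eq_inv_of_mul_eq_one_right hw)
    rw [this]
    exact (hkX.symm.mul_right ((Commute.refl (φ X)).zpow_right i)).inv_right
  obtain ⟨i, rfl⟩ := hi
  obtain ⟨j, rfl⟩ := hj
  rw [zpow_mul, zpow_mul, zpow_natCast, zpow_natCast]
  exact mul_mem (mul_mem (zpow_mem hXp _) (zpow_mem hYp _)) hk

end HyperbolicExtension

/-! ### Extending partial isomorphisms by hyperbolic pairs. -/

section Classification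

variable {p : ℕ} [hp : Fact p.Prime] {G H : Type*} [Group G] [Group H] {c : G} {d : H}

/-- A partial isomorphism between `G` and `H` whose domain and range are central factors. -/
structure IsCentralFactorIso (c : G) (d : H) (K : Subgroup (G × H)) : Prop where
  left : IsCentralFactor (K.map (MonoidHom.fst G H))
  right : IsCentralFactor (K.map (MonoidHom.snd G H))
  left_inj : ∀ k ∈ K, k.1 = 1 → k = 1
  right_inj : ∀ k ∈ K, k.2 = 1 → k = 1
  mem : (c, d) ∈ K

theorem isCentralFactorIso_of_center (θ : Subgroup.center G ≃* Subgroup.center H)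
    (hc : c ∈ Subgroup.center G) (hd : (θ ⟨c, hc⟩ : H) = d) :
    ∃ K : Subgroup (G × H), IsCentralFactorIso c d K ∧
      K.map (MonoidHom.fst G H) = Subgroup.center G ∧
      K.map (MonoidHom.snd G H) = Subgroup.center H ∧
      ∀ z : Subgroup.center G, ((z : G), (θ z : H)) ∈ K := by
  let K : Subgroup (G × H) := ((Subgroup.subtype (Subgroup.center G)).prod
    ((Subgroup.subtype (Subgroup.center H)).comp θ.toMonoidHom)).range
  have h1 : K.map (MonoidHom.fst G H) = Subgroup.center G := by
    rw [MonoidHom.map_range, MonoidHom.fst_comp_prod, Subgroup.range_subtype]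
  have h2 : K.map (MonoidHom.snd G H) = Subgroup.center H := by
    rw [MonoidHom.map_range, MonoidHom.snd_comp_prod, MonoidHom.range_comp,
      MonoidHom.range_eq_top.2 θ.surjective, ← MonoidHom.range_eq_map, Subgroup.range_subtype]
  refine ⟨K, ⟨h1 ▸ isCentralFactor_center, h2 ▸ isCentralFactor_center, ?_, ?_, ?_⟩, h1, h2, ?_⟩
  · rintro _ ⟨z, rfl⟩ hz
    have : z = 1 := Subtype.ext hz
    rw [this, map_one]
  · rintro _ ⟨z, rfl⟩ hz
    have h3 : θ z = 1 := Subtype.ext hz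
    have : z = 1 := by simpa using h3
    rw [this, map_one]
  · exact ⟨⟨c, hc⟩, Prod.ext rfl hd⟩
  · exact fun z => ⟨z, rfl⟩

theorem mk_mem_centralizer {K : Subgroup (G × H)} {x : G} {y : H}
    (hx : x ∈ Subgroup.centralizer (K.map (MonoidHom.fst G H) : Set G))
    (hy : y ∈ Subgroup.centralizer (K.map (MonoidHom.snd G H) : Set H)) :
    (x, y) ∈ Subgroup.centralizer (K : Set (G × H)) := fun k hk =>
  Prod.ext (hx k.1 ⟨k, hk, rfl⟩) (hy k.2 ⟨k, hk, rfl⟩)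

theorem IsCentralFactorIso.extend (hc : IsCommutatorGenerator p c) (hd : IsCommutatorGenerator p d)
    {K : Subgroup (G × H)} (hK : IsCentralFactorIso c d K) {x y : G} {x' y' : H}
    (hx : x ∈ Subgroup.centralizer (K.map (MonoidHom.fst G H) : Set G))
    (hy : y ∈ Subgroup.centralizer (K.map (MonoidHom.fst G H) : Set G))
    (hx' : x' ∈ Subgroup.centralizer (K.map (MonoidHom.snd G H) : Set H))
    (hy' : y' ∈ Subgroup.centralizer (K.map (MonoidHom.snd G H) : Set H))
    (hxy : x * y = c * y * x) (hxy' : x' * y' = d * y' * x')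
    (hxp : (x ^ p, x' ^ p) ∈ K) (hyp : (y ^ p, y' ^ p) ∈ K) :
    ∃ K' : Subgroup (G × H), IsCentralFactorIso c d K' ∧ K ≤ K' ∧ (x, x') ∈ K' ∧ (y, y') ∈ K' ∧
      ∀ w ∈ K', ∃ i j : ℤ, ∃ k ∈ K, w = (x, x') ^ i * (y, y') ^ j * k := by
  have hX := mk_mem_centralizer hx hx'
  have hY := mk_mem_centralizer hy hy'
  have hXY : ((x, x') : G × H) * (y, y') = (c, d) * (y, y') * (x, x') := Prod.ext hxy hxy'
  set K' := adjoinPair K hK.mem hX hY hXY with hK'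
  have hle : K ≤ K' := fun k hk => ⟨0, 0, k, hk, by simp⟩
  have hXK : (x, x') ∈ K' := ⟨1, 0, 1, one_mem _, by simp⟩
  have hYK : (y, y') ∈ K' := ⟨0, 1, 1, one_mem _, by simp⟩
  have hall : ∀ w ∈ K', ∃ i j : ℤ, ∃ k ∈ K, w = (x, x') ^ i * (y, y') ^ j * k := fun _ hw => hw
  refine ⟨K', ⟨?_, ?_, ?_, ?_, hle hK.mem⟩, hle, hXK, hYK, hall⟩
  · refine hK.left.extend hc hx hy hxy (Subgroup.map_mono hle) ⟨_, hXK, rfl⟩ ⟨_, hYK, rfl⟩ ?_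
    rintro _ ⟨w, hw, rfl⟩
    obtain ⟨i, j, k, hk, rfl⟩ := hall w hw
    exact ⟨i, j, k.1, ⟨k, hk, rfl⟩, rfl⟩
  · refine hK.right.extend hd hx' hy' hxy' (Subgroup.map_mono hle) ⟨_, hXK, rfl⟩ ⟨_, hYK, rfl⟩ ?_
    rintro _ ⟨w, hw, rfl⟩
    obtain ⟨i, j, k, hk, rfl⟩ := hall w hw
    exact ⟨i, j, k.2, ⟨k, hk, rfl⟩, rfl⟩
  · intro w hw hw1
    obtain ⟨i, j, k, hk, rfl⟩ := hall w hw
    exact hK.left_inj _ (mem_of_map_eq_one_of_mem_adjoinPair (MonoidHom.fst G H) hc hX hY hXY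
      hxp hyp hk hw1) hw1
  · intro w hw hw1
    obtain ⟨i, j, k, hk, rfl⟩ := hall w hw
    exact hK.right_inj _ (mem_of_map_eq_one_of_mem_adjoinPair (MonoidHom.snd G H) hd hX hY hXY
      hxp hyp hk hw1) hw1

/-- A central factor whose centralizer is central is the whole group; equal orders make it enough to
exhaust one side. -/
theorem IsCentralFactorIso.nonempty_mulEquiv [Finite G] [Finite H]
    (hcard : Nat.card G = Nat.card H) {K : Subgroup (G × H)} (hK : IsCentralFactorIso c d K)
    (h : (∀ e ∈ Subgroup.centralizer (K.map (MonoidHom.fst G H) : Set G), e ∈ Subgroup.center G) ∨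
      ∀ e ∈ Subgroup.centralizer (K.map (MonoidHom.snd G H) : Set H), e ∈ Subgroup.center H) :
    Nonempty (G ≃* H) := by
  rcases h with h | h
  · obtain ⟨e, -⟩ := nonempty_mulEquiv_of_subgroup_prod hcard K hK.left_inj hK.right_inj
      (hK.left.eq_top h)
    exact ⟨e⟩
  · exact nonempty_mulEquiv_of_subgroup_prod_snd hcard K hK.left_inj hK.right_inj
      (hK.right.eq_top h)

/-- Dividing two noncommuting elements by central elements with the same p-th powers makes both p-th
powers trivial; a power of the second normalizes the commutator to c. -/
theorem exists_pair_pow_eq_one (hp2 : p ≠ 2) (hc : IsCommutatorGenerator p c) {S : Subgroup G}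
    (hS : Subgroup.center G ≤ S)
    (h : ¬ ∀ x ∈ centralPowSubgroup hp2 hc, x ∈ S →
      ∀ y ∈ centralPowSubgroup hp2 hc, y ∈ S → Commute x y) :
    ∃ x ∈ S, ∃ y ∈ S, x ^ p = 1 ∧ y ^ p = 1 ∧ x * y = c * y * x := by
  push Not at h
  obtain ⟨x, ⟨z, hz, hxz⟩, hx, y, ⟨w, hw, hyw⟩, hy, hxy⟩ := h
  have hz' : ∀ g, Commute g z := fun g => Subgroup.mem_center_iff.1 hz g
  have hw' : ∀ g, Commute g w := fun g => Subgroup.mem_center_iff.1 hw g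
  have hne : (x * z⁻¹) * (y * w⁻¹) ≠ (y * w⁻¹) * (x * z⁻¹) := by
    intro h1
    refine hxy ?_
    have h2 : Commute (x * z⁻¹ * z) (y * w⁻¹ * w) :=
      ((show Commute (x * z⁻¹) (y * w⁻¹) from h1).mul_right (hw' _)).mul_left (hz' _).symm
    simpa using h2
  obtain ⟨m, hm⟩ := hc.exists_zpow_mul_eq hne
  refine ⟨x * z⁻¹, mul_mem hx (inv_mem (hS hz)), (y * w⁻¹) ^ m,
    zpow_mem (mul_mem hy (inv_mem (hS hw))) m, ?_, ?_, hm⟩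
  · rw [hc.mul_pow_prime hp2, hxz, inv_pow, mul_inv_cancel]
  · rw [← zpow_natCast, ← zpow_mul, mul_comm, zpow_mul, zpow_natCast, hc.mul_pow_prime hp2, hyw,
      inv_pow, mul_inv_cancel, one_zpow]

/-- Hyperbolic pairs of order `p` are adjoined to a partial isomorphism as long as possible. -/
theorem exists_maximal_isCentralFactorIso [Finite G] [Finite H] (hp2 : p ≠ 2)
    (hc : IsCommutatorGenerator p c) (hd : IsCommutatorGenerator p d)
    {K₀ : Subgroup (G × H)} (hK₀ : IsCentralFactorIso c d K₀)
    (h1 : K₀.map (MonoidHom.fst G H) ≤ centralPowSubgroup hp2 hc)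
    (h2 : K₀.map (MonoidHom.snd G H) ≤ centralPowSubgroup hp2 hd) :
    ∃ K : Subgroup (G × H), K₀ ≤ K ∧ IsCentralFactorIso c d K ∧
      K.map (MonoidHom.fst G H) ≤ centralPowSubgroup hp2 hc ∧
      K.map (MonoidHom.snd G H) ≤ centralPowSubgroup hp2 hd ∧
      ((∀ x ∈ centralPowSubgroup hp2 hc,
          x ∈ Subgroup.centralizer (K.map (MonoidHom.fst G H) : Set G) →
        ∀ y ∈ centralPowSubgroup hp2 hc,
          y ∈ Subgroup.centralizer (K.map (MonoidHom.fst G H) : Set G) → Commute x y) ∨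
      (∀ x ∈ centralPowSubgroup hp2 hd,
          x ∈ Subgroup.centralizer (K.map (MonoidHom.snd G H) : Set H) →
        ∀ y ∈ centralPowSubgroup hp2 hd,
          y ∈ Subgroup.centralizer (K.map (MonoidHom.snd G H) : Set H) → Commute x y)) := by
  let S : Set (Subgroup (G × H)) := {K | IsCentralFactorIso c d K ∧
      K.map (MonoidHom.fst G H) ≤ centralPowSubgroup hp2 hc ∧
      K.map (MonoidHom.snd G H) ≤ centralPowSubgroup hp2 hd}
  obtain ⟨K, hK₀K, hKmax⟩ := (Set.toFinite S).exists_le_maximal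
    (show K₀ ∈ S from ⟨hK₀, h1, h2⟩)
  obtain ⟨hK, hK1, hK2⟩ := hKmax.prop
  refine ⟨K, hK₀K, hK, hK1, hK2, ?_⟩
  by_contra! hcon
  obtain ⟨hn1, hn2⟩ := hcon
  obtain ⟨x, hx, y, hy, hxp, hyp, hxy⟩ := exists_pair_pow_eq_one hp2 hc
    (Subgroup.center_le_centralizer _) (fun h => by
      obtain ⟨a, ha, ha', b, hb, hb', hab⟩ := hn1
      exact hab (h a ha ha' b hb hb'))
  obtain ⟨x', hx', y', hy', hxp', hyp', hxy'⟩ := exists_pair_pow_eq_one hp2 hd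
    (Subgroup.center_le_centralizer _) (fun h => by
      obtain ⟨a, ha, ha', b, hb, hb', hab⟩ := hn2
      exact hab (h a ha ha' b hb hb'))
  obtain ⟨K', hK', hle, hxK, hyK, hall⟩ := hK.extend hc hd hx hy hx' hy' hxy hxy'
    (by rw [hxp, hxp']; exact one_mem K) (by rw [hyp, hyp']; exact one_mem K)
  have hS : K' ∈ S := by
    refine ⟨hK', ?_, ?_⟩
    · rintro _ ⟨w, hw, rfl⟩
      obtain ⟨i, j, k, hk, rfl⟩ := hall w hw
      exact mul_mem (mul_mem (zpow_mem (mem_centralPowSubgroup_of_pow_eq_one hxp) i)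
        (zpow_mem (mem_centralPowSubgroup_of_pow_eq_one hyp) j)) (hK1 ⟨k, hk, rfl⟩)
    · rintro _ ⟨w, hw, rfl⟩
      obtain ⟨i, j, k, hk, rfl⟩ := hall w hw
      exact mul_mem (mul_mem (zpow_mem (mem_centralPowSubgroup_of_pow_eq_one hxp') i)
        (zpow_mem (mem_centralPowSubgroup_of_pow_eq_one hyp') j)) (hK2 ⟨k, hk, rfl⟩)
  -- Maximality puts x in the domain of K, which y centralizes, contradicting c ≠ 1.
  have hxK' : x ∈ K.map (MonoidHom.fst G H) := ⟨(x, x'), hKmax.le_of_ge hS hle hxK, rfl⟩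
  have hcomm : Commute x y := hy x hxK'
  have := hc.dvd_of_commute_zpow hxy (i := 1) (by rwa [zpow_one])
  exact hp.out.one_lt.ne' (by exact_mod_cast Int.eq_one_of_dvd_one (by positivity) this)

/-- In the absence of central elements with `p`-th power `b`, one more pair `x`, `y` with
`x ^ p = b` can be split off. -/
theorem IsCentralFactor.exists_pair_pow_eq (hp2 : p ≠ 2) (hc : IsCommutatorGenerator p c)
    {D : Subgroup G} (hD : IsCentralFactor D) (hDN : D ≤ centralPowSubgroup hp2 hc) {b x₀ : G}
    (hb : b ∈ Subgroup.center G) {k : ℕ} (hbk : orderOf b = p ^ k) (hx₀ : x₀ ^ p = b)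
    (hbN : ∀ z ∈ Subgroup.center G, z ^ p ≠ b) (hpow : ∀ g : G, g ^ p ∈ Subgroup.zpowers b) :
    ∃ x ∈ Subgroup.centralizer (D : Set G), ∃ y ∈ Subgroup.centralizer (D : Set G),
      x ^ p = b ∧ y ^ p = 1 ∧ x * y = c * y * x := by
  have hx₀N : x₀ ∉ centralPowSubgroup hp2 hc := by
    rintro ⟨z, hz, hxz⟩
    exact hbN z hz (hxz ▸ hx₀)
  obtain ⟨u, hu, w, hw, huw⟩ := hD.exists_mul x₀
  -- Only the component w in the centralizer of D can carry the p-th power: w^p = b^i with i prime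
  -- to p, so a power of w has p-th power b.
  have hwN : w ∉ centralPowSubgroup hp2 hc := fun h => hx₀N (huw ▸ mul_mem (hDN hu) h)
  obtain ⟨i, hi⟩ := hpow w
  simp only at hi
  have hpi : ¬ (p : ℤ) ∣ i := by
    rintro ⟨j, rfl⟩
    refine hwN ⟨b ^ j, zpow_mem hb j, ?_⟩
    rw [← hi, mul_comm, zpow_mul, zpow_natCast]
  have hcop : IsCoprime ((p : ℤ) ^ k) i :=
    ((Prime.coprime_iff_not_dvd (Nat.prime_iff_prime_int.1 hp.out)).2 hpi).pow_left
  obtain ⟨r, m, hrm⟩ := hcop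
  set x := w ^ m with hx
  have hxp : x ^ p = b := by
    rw [hx, ← zpow_natCast, ← zpow_mul, mul_comm m, zpow_mul, zpow_natCast, ← hi, ← zpow_mul,
      show i * m = 1 - r * (p : ℤ) ^ k by linear_combination hrm, zpow_sub, zpow_one, mul_comm r,
      zpow_mul]
    have : b ^ ((p : ℤ) ^ k) = 1 := by
      rw [← orderOf_dvd_iff_zpow_eq_one, hbk]
      push_cast
      exact dvd_rfl
    rw [this, one_zpow, inv_one, mul_one]
  have hxC : x ∈ Subgroup.centralizer (D : Set G) := zpow_mem hw m
  have hxZ : x ∉ Subgroup.center G := fun h => hbN x h hxp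
  obtain ⟨f, hf, hxf⟩ : ∃ f ∈ Subgroup.centralizer (D : Set G), ¬ Commute x f := by
    by_contra! h
    exact hxZ (hD.mem_center hxC h)
  obtain ⟨j, hj⟩ := hpow f
  simp only at hj
  -- Correcting f by a power of x kills its p-th power and keeps it from commuting with x.
  have hyp : (f * x ^ (-j)) ^ p = 1 := by
    rw [hc.mul_pow_prime hp2, ← hj, ← zpow_natCast (x ^ (-j)), ← zpow_mul, mul_comm (-j), zpow_mul,
      zpow_natCast, hxp, ← zpow_add, add_neg_cancel, zpow_zero]
  have hxy : x * (f * x ^ (-j)) ≠ (f * x ^ (-j)) * x := by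
    intro h
    refine hxf ?_
    have : Commute x (f * x ^ (-j) * x ^ j) :=
      (show Commute x (f * x ^ (-j)) from h).mul_right ((Commute.refl x).zpow_right j)
    simpa using this
  obtain ⟨n, hn⟩ := hc.exists_zpow_mul_eq hxy
  refine ⟨x, hxC, (f * x ^ (-j)) ^ n, zpow_mem (mul_mem hf (zpow_mem hxC _)) n, hxp, ?_, hn⟩
  rw [← zpow_natCast, ← zpow_mul, mul_comm, zpow_mul, zpow_natCast, hyp, one_zpow]

/-- Every element of the centralizer of D is x^i n with n in its commutative part
`centralPowSubgroup`. If e = x^i n commutes with y, then so does x^i, hence p ∣ i and x^i is a power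
of the central b; what remains commutes with x and with all such n. -/
theorem IsCentralFactor.mem_center_of_commute_pair (hp2 : p ≠ 2) (hc : IsCommutatorGenerator p c)
    {D : Subgroup G} (hD : IsCentralFactor D) {b x y : G} (hb : b ∈ Subgroup.center G)
    (hpow : ∀ g : G, g ^ p ∈ Subgroup.zpowers b)
    (hab : ∀ x ∈ centralPowSubgroup hp2 hc, x ∈ Subgroup.centralizer (D : Set G) →
        ∀ y ∈ centralPowSubgroup hp2 hc, y ∈ Subgroup.centralizer (D : Set G) → Commute x y)
    (hx : x ∈ Subgroup.centralizer (D : Set G)) (hy : y ∈ Subgroup.centralizer (D : Set G))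
    (hxp : x ^ p = b) (hyp : y ^ p = 1) (hxy : x * y = c * y * x) {e : G}
    (he : e ∈ Subgroup.centralizer (D : Set G)) (hex : Commute e x) (hey : Commute e y) :
    e ∈ Subgroup.center G := by
  have hdecomp : ∀ f ∈ Subgroup.centralizer (D : Set G), ∃ i : ℤ, ∃ n ∈ centralPowSubgroup hp2 hc,
      n ∈ Subgroup.centralizer (D : Set G) ∧ f = x ^ i * n := by
    intro f hf
    obtain ⟨i, hi⟩ := hpow f
    simp only at hi
    refine ⟨i, x ^ (-i) * f, mem_centralPowSubgroup_of_pow_eq_one ?_,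
      mul_mem (zpow_mem hx _) hf, by group⟩
    rw [hc.mul_pow_prime hp2, ← hi, ← zpow_natCast (x ^ (-i)), ← zpow_mul, mul_comm (-i), zpow_mul,
      zpow_natCast, hxp, ← zpow_add, neg_add_cancel, zpow_zero]
  obtain ⟨i, n, hnN, hnC, rfl⟩ := hdecomp e he
  have hny : Commute n y := hab n hnN hnC y (mem_centralPowSubgroup_of_pow_eq_one hyp) hy
  obtain ⟨i, rfl⟩ : (p : ℤ) ∣ i := by
    refine hc.dvd_of_commute_zpow hxy ?_
    have : Commute (x ^ i * n * n⁻¹) y := hey.mul_left hny.inv_left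
    simpa using this
  have hxi : ∀ g, Commute (x ^ ((p : ℤ) * i)) g := by
    intro g
    rw [zpow_mul, zpow_natCast, hxp]
    exact (show Commute b g from (Subgroup.mem_center_iff.1 hb g).symm).zpow_left i
  refine hD.mem_center he fun f hf => ?_
  obtain ⟨j, n', hnN', hnC', rfl⟩ := hdecomp f hf
  exact (hex.zpow_right j).mul_right ((hxi n').mul_left (hab n hnN hnC n' hnN' hnC'))

end Classification

/-! ### The four invariants determine the group. -/

section Invariants

open scoped IsMulCommutative

variable {p : ℕ} [hp : Fact p.Prime] {G H : Type*} [Group G] [Group H]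

omit hp in
theorem IsCommutatorGenerator.of_mem_zpowers [Finite G] {a c c' : G}
    (hc : IsCommutatorGenerator p c) (hca : c ∈ Subgroup.zpowers a)
    (hca' : c' ∈ Subgroup.zpowers a) (ho : orderOf c' = p) : IsCommutatorGenerator p c' := by
  have h1 : c' ∈ Subgroup.zpowers c :=
    mem_zpowers_of_orderOf_dvd hca hca' (by rw [ho, hc.orderOf_eq])
  have h2 : c ∈ Subgroup.zpowers c' :=
    mem_zpowers_of_orderOf_dvd hca' hca (by rw [ho, hc.orderOf_eq])
  refine ⟨(Subgroup.zpowers_le.2 hc.mem_center) h1, ho, fun g h => ?_⟩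
  obtain ⟨i, hi⟩ := hc.exists_pow g h
  obtain ⟨j, hj⟩ := mem_powers_iff_mem_zpowers.2 (pow_mem h2 i)
  simp only at hj
  exact ⟨j, by rw [hj, hi]⟩

/-- A central element `b` of maximal order with a power generating the commutator subgroup, which
controls the `p`-th powers. -/
structure IsCenterGenerator (p k : ℕ) (b : G) : Prop where
  isCommutatorGenerator : IsCommutatorGenerator p (b ^ p ^ k)
  mem_center : b ∈ Subgroup.center G
  exponent_center : Monoid.exponent (Subgroup.center G) = p ^ (k + 1)
  orderOf_eq : orderOf b = p ^ (k + 1)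
  pow_mem : ∀ z ∈ Subgroup.center G, z ^ p ∈ Subgroup.zpowers (b ^ p)
  exists_center_pow_eq : Monoid.exponent G = Monoid.exponent (Subgroup.center G) →
    ∀ g : G, ∃ z ∈ Subgroup.center G, g ^ p = z ^ p
  exists_pow_eq : Monoid.exponent G ≠ Monoid.exponent (Subgroup.center G) → ∃ x : G, x ^ p = b
  pow_mem_of_exponent_ne : Monoid.exponent G ≠ Monoid.exponent (Subgroup.center G) →
    ∀ g : G, g ^ p ∈ Subgroup.zpowers b

/-- Otherwise b^(p^k) = z^(p^(k+1)) = 1 by the exponent of the center, although this power has order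
p. -/
theorem IsCenterGenerator.pow_ne {k : ℕ} {b : G} (hb : IsCenterGenerator p k b) {z : G}
    (hz : z ∈ Subgroup.center G) : z ^ p ≠ b := by
  rintro rfl
  have h1 : z ^ p ^ (k + 1) = 1 := by
    rw [← hb.exponent_center]
    exact congrArg Subtype.val (Monoid.pow_exponent_eq_one (⟨z, hz⟩ : Subgroup.center G))
  have h2 : (z ^ p) ^ p ^ k = 1 := by rw [← pow_mul, ← pow_succ', h1]
  have h3 := hb.isCommutatorGenerator.orderOf_eq
  rw [h2, orderOf_one] at h3
  exact hp.out.one_lt.ne h3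

theorem exists_isCenterGenerator (hp2 : p ≠ 2) [Finite G] (hG : IsPGroup p G)
    (hna : ∃ a b : G, a * b ≠ b * a) (hΦ : IsCyclic (frattini G)) :
    ∃ (k : ℕ) (b : G), IsCenterGenerator p k b := by
  obtain ⟨a, c, hc, hpow, hca, hpa⟩ := exists_isCommutatorGenerator hp2 hG hna hΦ
  obtain ⟨z₀, hz₀⟩ := Monoid.exists_orderOf_eq_exponent
    (Monoid.ExponentExists.of_finite (G := Subgroup.center G))
  have hz : ∀ z ∈ Subgroup.center G, z ^ Monoid.exponent (Subgroup.center G) = 1 := fun z hz =>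
    congrArg Subtype.val (Monoid.pow_exponent_eq_one (⟨z, hz⟩ : Subgroup.center G))
  obtain ⟨k, hk⟩ : ∃ k, Monoid.exponent (Subgroup.center G) = p ^ (k + 1) := by
    obtain ⟨k, hk⟩ := (IsPGroup.iff_orderOf.1 (hG.to_subgroup (Subgroup.center G))) z₀
    rw [hz₀] at hk
    rcases k with - | k
    · have h1 := hz c hc.mem_center
      rw [hk, pow_zero, pow_one] at h1
      have h2 := hc.orderOf_eq
      rw [h1, orderOf_one] at h2
      exact absurd h2 hp.out.one_lt.ne
    · exact ⟨k, hk⟩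
  rw [hk] at hz hz₀
  have hdvd : ∀ g : G, g ^ p ^ (k + 1) = 1 → orderOf (g ^ p) ∣ p ^ k := fun g hg => by
    rw [orderOf_dvd_iff_pow_eq_one, ← pow_mul, ← pow_succ', hg]
  have hordp : ∀ {b : G} {n m : ℕ}, orderOf b = p ^ (n + m) → orderOf (b ^ p ^ n) = p ^ m := by
    intro b n m hb
    rw [orderOf_pow_of_dvd (pow_pos hp.out.pos n).ne' (by rw [hb]; exact pow_dvd_pow _ (by omega)),
      hb, pow_add, Nat.mul_div_cancel_left _ (pow_pos hp.out.pos n)]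
  -- All p-th powers lie in the cyclic group ⟨a⟩, where membership in a subgroup is decided by
  -- orders.
  have main : ∀ b ∈ Subgroup.center G, orderOf b = p ^ (k + 1) →
      b ^ p ^ k ∈ Subgroup.zpowers a →
      (Monoid.exponent G ≠ Monoid.exponent (Subgroup.center G) →
        (∃ x : G, x ^ p = b) ∧ b ∈ Subgroup.zpowers a) → IsCenterGenerator p k b := by
    intro b hb hbo hba hne
    have hbp : orderOf (b ^ p) = p ^ k := by
      have := hordp (n := 1) (m := k) (b := b) (by rw [hbo, add_comm])
      rwa [pow_one] at this
    have hmem : ∀ g : G, g ^ p ^ (k + 1) = 1 → g ^ p ∈ Subgroup.zpowers (b ^ p) := fun g hg =>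
      mem_zpowers_of_orderOf_dvd (hpa b) (hpa g) (by rw [hbp]; exact hdvd g hg)
    refine ⟨hc.of_mem_zpowers hca hba ?_, hb, hk, hbo, fun z hz' => hmem z (hz z hz'), ?_,
      fun h => (hne h).1, fun h g => mem_zpowers_of_orderOf_dvd (hne h).2 (hpa g) ?_⟩
    · have := hordp (n := k) (m := 1) hbo
      rwa [pow_one] at this
    · intro h g
      obtain ⟨i, hi⟩ := hmem g (by rw [← hk, ← h, Monoid.pow_exponent_eq_one])
      refine ⟨b ^ i, zpow_mem hb i, ?_⟩
      simp only at hi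
      rw [← hi, ← zpow_natCast, ← zpow_natCast, zpow_comm]
    · rw [hbo, orderOf_dvd_iff_pow_eq_one]
      exact hz _ (hpow g)
  by_cases hexp : Monoid.exponent G = Monoid.exponent (Subgroup.center G)
  -- `main` needs b^(p^k) in ⟨a⟩, which is automatic for a p-th power. For k = 0 the element b
  -- itself must lie in ⟨a⟩, hence the choice b = c.
  · rcases k with - | k
    · exact ⟨0, c, main c hc.mem_center (by rw [hc.orderOf_eq, zero_add, pow_one])
        (by rwa [pow_zero, pow_one]) fun h => absurd hexp h⟩
    · refine ⟨k + 1, z₀, main z₀ z₀.2 (by rw [Subgroup.orderOf_coe, hz₀]) ?_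
        fun h => absurd hexp h⟩
      rw [pow_succ', pow_mul]
      exact pow_mem (hpa _) _
  · obtain ⟨x, hx⟩ : ∃ x : G, x ^ p ^ (k + 1) ≠ 1 := by
      by_contra! h
      refine hexp (Nat.dvd_antisymm ?_ ?_)
      · rw [hk]
        exact Monoid.exponent_dvd_of_forall_pow_eq_one h
      · exact Monoid.exponent_dvd_of_forall_pow_eq_one fun z =>
          Subtype.ext (Monoid.pow_exponent_eq_one (z : G))
    -- With x of order above exp Z(G), the central element x^p has maximal order p^(k+1) and is a
    -- p-th power.
    refine ⟨k, x ^ p, main _ (hpow x) (orderOf_eq_prime_pow ?_ (hz _ (hpow x)))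
      (pow_mem (hpa x) _) fun _ => ⟨⟨x, rfl⟩, hpa x⟩⟩
    rwa [← pow_mul, ← pow_succ']

theorem IsCenterGenerator.exists_mulEquiv_center [Finite G] [Finite H] {k : ℕ} {b : G} {b' : H}
    (hb : IsCenterGenerator p k b) (hb' : IsCenterGenerator p k b')
    (hcard : Nat.card (Subgroup.center G) = Nat.card (Subgroup.center H)) :
    ∃ θ : Subgroup.center G ≃* Subgroup.center H, θ ⟨b, hb.mem_center⟩ = ⟨b', hb'.mem_center⟩ := by
  refine exists_mulEquiv_of_pow_mem_zpowers (p := p) hcard ?_ ?_ ?_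
  · rw [← Subgroup.orderOf_coe, ← Subgroup.orderOf_coe, hb.orderOf_eq, hb'.orderOf_eq]
  · intro z
    obtain ⟨i, hi⟩ := hb.pow_mem z z.2
    exact ⟨i, Subtype.ext hi⟩
  · intro z
    obtain ⟨i, hi⟩ := hb'.pow_mem z z.2
    exact ⟨i, Subtype.ext hi⟩

/-- Finite nonabelian `p`-groups with cyclic Frattini subgroup are determined by four numerical
invariants. -/
theorem nonempty_mulEquiv_of_invariants_eq (hp2 : p ≠ 2) [Finite G] [Finite H]
    (hG : IsPGroup p G) (hGna : ∃ a b : G, a * b ≠ b * a) (hGΦ : IsCyclic (frattini G))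
    (hH : IsPGroup p H) (hHna : ∃ a b : H, a * b ≠ b * a) (hHΦ : IsCyclic (frattini H))
    (hcard : Nat.card G = Nat.card H)
    (hcardZ : Nat.card (Subgroup.center G) = Nat.card (Subgroup.center H))
    (hexpZ : Monoid.exponent (Subgroup.center G) = Monoid.exponent (Subgroup.center H))
    (hexp : Monoid.exponent G = Monoid.exponent H) : Nonempty (G ≃* H) := by
  obtain ⟨k, b, hb⟩ := exists_isCenterGenerator hp2 hG hGna hGΦ
  obtain ⟨k', b', hb'⟩ := exists_isCenterGenerator hp2 hH hHna hHΦ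
  obtain rfl : k = k' := by
    have := hexpZ
    rw [hb.exponent_center, hb'.exponent_center] at this
    exact Nat.succ_injective (Nat.pow_right_injective hp.out.two_le this)
  obtain ⟨θ, hθ⟩ := hb.exists_mulEquiv_center hb' hcardZ
  have hc := hb.isCommutatorGenerator
  have hd := hb'.isCommutatorGenerator
  obtain ⟨K₀, hK₀, h1, h2, hθK⟩ := isCentralFactorIso_of_center (d := b' ^ p ^ k) θ hc.mem_center
    (by
      have : (⟨b ^ p ^ k, hc.mem_center⟩ : Subgroup.center G) = ⟨b, hb.mem_center⟩ ^ p ^ k := rfl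
      rw [this, map_pow, hθ]
      rfl)
  have hbK₀ : (b, b') ∈ K₀ := by
    have := hθK ⟨b, hb.mem_center⟩
    rwa [hθ] at this
  obtain ⟨K, hle, hK, hK1, hK2, hab⟩ := exists_maximal_isCentralFactorIso hp2 hc hd hK₀
    (h1 ▸ center_le_centralPowSubgroup) (h2 ▸ center_le_centralPowSubgroup)
  -- When the exponents agree, every element lies in `centralPowSubgroup`, so the maximal partial
  -- isomorphism already exhausts one side. Otherwise one pair with x^p = b remains on each side and
  -- is adjoined.
  by_cases hex : Monoid.exponent G = Monoid.exponent (Subgroup.center G)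
  · have hex' : Monoid.exponent H = Monoid.exponent (Subgroup.center H) := by
      rw [← hexp, hex, hexpZ]
    refine hK.nonempty_mulEquiv hcard (hab.imp (fun hab e he => ?_) fun hab e he => ?_)
    · exact hK.left.mem_center he fun f hf =>
        hab e (hb.exists_center_pow_eq hex e) he f (hb.exists_center_pow_eq hex f) hf
    · exact hK.right.mem_center he fun f hf =>
        hab e (hb'.exists_center_pow_eq hex' e) he f (hb'.exists_center_pow_eq hex' f) hf
  · have hex' : Monoid.exponent H ≠ Monoid.exponent (Subgroup.center H) := by
      rwa [← hexp, ← hexpZ]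
    obtain ⟨x₀, hx₀⟩ := hb.exists_pow_eq hex
    obtain ⟨x₀', hx₀'⟩ := hb'.exists_pow_eq hex'
    have hpow := hb.pow_mem_of_exponent_ne hex
    have hpow' := hb'.pow_mem_of_exponent_ne hex'
    obtain ⟨x, hx, y, hy, hxp, hyp, hxy⟩ := hK.left.exists_pair_pow_eq hp2 hc hK1 hb.mem_center
      hb.orderOf_eq hx₀ (fun z hz => hb.pow_ne hz) hpow
    obtain ⟨x', hx', y', hy', hxp', hyp', hxy'⟩ := hK.right.exists_pair_pow_eq hp2 hd hK2
      hb'.mem_center hb'.orderOf_eq hx₀' (fun z hz => hb'.pow_ne hz) hpow'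
    obtain ⟨K', hK', hKK', hxK', hyK', -⟩ := hK.extend hc hd hx hy hx' hy' hxy hxy'
      (by rw [hxp, hxp']; exact hle hbK₀) (by rw [hyp, hyp']; exact one_mem K)
    refine hK'.nonempty_mulEquiv hcard (hab.imp (fun hab e he => ?_) fun hab e he => ?_)
    · exact hK.left.mem_center_of_commute_pair hp2 hc hb.mem_center hpow hab hx hy hxp hyp hxy
        (Subgroup.centralizer_le (Subgroup.map_mono hKK') he)
        (he x ⟨_, hxK', rfl⟩).symm (he y ⟨_, hyK', rfl⟩).symm
    · exact hK.right.mem_center_of_commute_pair hp2 hd hb'.mem_center hpow' hab hx' hy' hxp' hyp'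
        hxy' (Subgroup.centralizer_le (Subgroup.map_mono hKK') he)
        (he x' ⟨_, hxK', rfl⟩).symm (he y' ⟨_, hyK', rfl⟩).symm

end Invariants

theorem mainTheorem1 (p : ℕ) (hp : p.Prime) (hp2 : 2 < p)
    (G : Type*) [Group G] [Finite G] (hG : IsPGroup p G)
    (hGna : ∃ a b : G, a * b ≠ b * a) (hGΦ : IsCyclic (frattini G))
    (H : Type*) [Group H] [Finite H] (hH : IsPGroup p H)
    (hHna : ∃ a b : H, a * b ≠ b * a) (hHΦ : IsCyclic (frattini H)) :
    (Nonempty (normalizedUnits (ZMod p) G ≃* normalizedUnits (ZMod p) H) ↔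
      Nonempty (G ≃* H)) ∧
    (Nonempty (normalizedUnits (ZMod p) G ≃* normalizedUnits (ZMod p) H) →
      Nat.card G = Nat.card H ∧
      Nat.card (Subgroup.center G) = Nat.card (Subgroup.center H) ∧
      Monoid.exponent (Subgroup.center G) = Monoid.exponent (Subgroup.center H) ∧
      Monoid.exponent G = Monoid.exponent H) ∧
    (Nat.card G = Nat.card H ∧
      Nat.card (Subgroup.center G) = Nat.card (Subgroup.center H) ∧
      Monoid.exponent (Subgroup.center G) = Monoid.exponent (Subgroup.center H) ∧
      Monoid.exponent G = Monoid.exponent H →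
      Nonempty (G ≃* H)) := by

  have := Fact.mk hp
  have hp2' : p ≠ 2 := hp2.ne'
  have hinv : Nonempty (normalizedUnits (ZMod p) G ≃* normalizedUnits (ZMod p) H) →
      Nat.card G = Nat.card H ∧
      Nat.card (Subgroup.center G) = Nat.card (Subgroup.center H) ∧
      Monoid.exponent (Subgroup.center G) = Monoid.exponent (Subgroup.center H) ∧
      Monoid.exponent G = Monoid.exponent H := by
    rintro ⟨e⟩
    obtain ⟨-, c, hc, hpow, -, -⟩ := exists_isCommutatorGenerator hp2' hG hGna hGΦ
    obtain ⟨-, d, hd, hpow', -, -⟩ := exists_isCommutatorGenerator hp2' hH hHna hHΦ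
    exact invariants_of_mulEquiv_normalizedUnits hp2' hc hpow hG hd hpow' hH e
  have hiso : Nat.card G = Nat.card H ∧
      Nat.card (Subgroup.center G) = Nat.card (Subgroup.center H) ∧
      Monoid.exponent (Subgroup.center G) = Monoid.exponent (Subgroup.center H) ∧
      Monoid.exponent G = Monoid.exponent H → Nonempty (G ≃* H) := fun ⟨h1, h2, h3, h4⟩ =>
    nonempty_mulEquiv_of_invariants_eq hp2' hG hGna hGΦ hH hHna hHΦ h1 h2 h3 h4
  exact ⟨⟨fun h => hiso (hinv h), fun ⟨e⟩ => nonempty_mulEquiv_normalizedUnits (ZMod p) e⟩,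
    hinv, hiso⟩
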